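/- Write $\log$ for the natural logarithm. For a finite graph $G$ with vertex set $V$, a box (cube) representation of $G$ of dimension $k\ge 0$ is a family $I_1,\dots,I_k$ of interval graphs (unit interval graphs) on the vertex set $V$ such that $E(G)=E(I_1)\cap\dots\cap E(I_k)$, where the empty family ($k=0$) represents exactly the complete graph on $V$; an interval graph (unit interval graph) is the intersection graph of nonempty closed intervals (closed intervals of length $1$) of the real line. The boxicity $\operatorname{box}(G)$ (cubicity $\operatorname{cub}(G)$) is the least dimension of a box (cube) representation of $G$. There is a polynomial-time algorithm which, given a graph $G$ on $n$ vertices, computes a box representation $\mathcal B$ of $G$ (by listing the end points of all intervals) such that, if $n\ge 3$, $$|\mathcal B|\le 2\left\lceil \frac{n\sqrt{\log\log n}}{\sqrt{\log n}}\right\rceil \operatorname{box}(G).$$ Further, there is a polynomial-time algorithm which, given a graph $G$ on $n$ vertices, computes a cube representation $\mathcal C$ of $G$ (by listing the rational left end points of all unit intervals) such that, if $n\ge 3$, $$|\mathcal C|\le 2\left\lceil \frac{n(\log\log n)^{3/2}}{\sqrt{\log n}}\right\rceil \operatorname{cub}(G).$$ Here $|\cdot|$ denotes the dimension, and polynomial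 time means that the number of steps of a random access machine (unit cost, with addition and subtraction), given the adjacency matrix of $G$, is at most a polynomial in $n$. -/

import Mathlib

namespace Boxicity

section Graphs

variable {V : Type*}

/-- The intersection graph of the closed real intervals `[l v, r v]`, `v ∈ V`. -/
def intervalGraph (l r : V → ℝ) : SimpleGraph V where
  Adj u v := u ≠ v ∧ (Set.Icc (l u) (r u) ∩ Set.Icc (l v) (r v)).Nonempty
  symm := ⟨fun _ _ h => ⟨h.1.symm, by rw [Set.inter_comm]; exact h.2⟩⟩
  loopless := ⟨fun _ h => h.1 rfl⟩

/-- `I` is an interval graph: the intersection graph of nonempty closed intervals. -/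
def IsIntervalGraph (I : SimpleGraph V) : Prop :=
  ∃ l r : V → ℝ, (∀ v, l v ≤ r v) ∧ I = intervalGraph l r

/-- `I` is a unit interval graph: the intersection graph of closed intervals of length one. -/
def IsUnitIntervalGraph (I : SimpleGraph V) : Prop :=
  ∃ l : V → ℝ, I = intervalGraph l (fun v => l v + 1)

/-- `I₁, …, I_k` is a box representation of `G` of dimension `k`: each `I_i` is an interval graph
on the vertex set of `G` and `E(G) = E(I₁) ∩ ⋯ ∩ E(I_k)`. The empty family represents exactly the
complete graph. -/
def IsBoxRepresentation (G : SimpleGraph V) {k : ℕ} (I : Fin k → SimpleGraph V) : Prop :=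
  (∀ i, IsIntervalGraph (I i)) ∧ G = ⨅ i, I i

/-- As `IsBoxRepresentation`, with unit interval graphs. -/
def IsCubeRepresentation (G : SimpleGraph V) {k : ℕ} (I : Fin k → SimpleGraph V) : Prop :=
  (∀ i, IsUnitIntervalGraph (I i)) ∧ G = ⨅ i, I i

/-- The boxicity: the least dimension of a box representation (zero for complete graphs). -/
noncomputable def box (G : SimpleGraph V) : ℕ :=
  sInf {k | ∃ I : Fin k → SimpleGraph V, IsBoxRepresentation G I}

/-- The cubicity: the least dimension of a cube representation (zero for complete graphs). -/
noncomputable def cub (G : SimpleGraph V) : ℕ :=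
  sInf {k | ∃ I : Fin k → SimpleGraph V, IsCubeRepresentation G I}

end Graphs

/-!
### Random access machine

Structured programs for a unit-cost random access machine. The machine has integer variables and
integer arrays (a program mentions only finitely many of each, array cells are addressed
indirectly); its arithmetic is addition and truncated subtraction. There is no multiplication, so
numbers have at most linearly many bits in the number of steps, and polynomial time on this
machine is polynomial time on a Turing machine.
-/

/-- Contents of the variables and of the arrays. -/
structure State where
  /-- the value of variable `x` -/
  var : ℕ → ℕ
  /-- the value of cell `i` of array `a` -/
  arr : ℕ → ℕ → ℕ

/-- `x := m`. -/
def State.setVar (s : State) (x m : ℕ) : State :=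
  { s with var := Function.update s.var x m }

/-- `a[i] := m`. -/
def State.setArr (s : State) (a i m : ℕ) : State :=
  { s with arr := Function.update s.arr a (Function.update (s.arr a) i m) }

/-- Arithmetic expressions. -/
inductive Expr where
  | const (c : ℕ)
  | var (x : ℕ)
  | read (a : ℕ) (i : Expr)
  | add (e f : Expr)
  | sub (e f : Expr)

/-- The value of an expression. -/
def Expr.eval (s : State) : Expr → ℕ
  | const c => c
  | var x => s.var x
  | read a i => s.arr a (i.eval s)
  | add e f => e.eval s + f.eval s
  | sub e f => e.eval s - f.eval s

/-- The time to evaluate an expression: one step for every operation. -/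
def Expr.cost : Expr → ℕ
  | const _ => 1
  | var _ => 1
  | read _ i => i.cost + 1
  | add e f => e.cost + f.cost + 1
  | sub e f => e.cost + f.cost + 1

/-- Programs. A test counts as true if its value is not zero. -/
inductive Prog where
  /-- do nothing -/
  | skip
  /-- `x := e` -/
  | assign (x : ℕ) (e : Expr)
  /-- `a[i] := e` -/
  | write (a : ℕ) (i e : Expr)
  /-- `p; q` -/
  | seq (p q : Prog)
  /-- if `e` then `p` else `q` -/
  | cond (e : Expr) (p q : Prog)
  /-- while `e` do `p` -/
  | loop (e : Expr) (p : Prog)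

/-- `Exec p s s' t`: started in state `s`, the program `p` halts in state `s'` after exactly `t`
steps. -/
inductive Exec : Prog → State → State → ℕ → Prop where
  | skip (s : State) : Exec .skip s s 1
  | assign (x : ℕ) (e : Expr) (s : State) :
      Exec (.assign x e) s (s.setVar x (e.eval s)) (e.cost + 1)
  | write (a : ℕ) (i e : Expr) (s : State) :
      Exec (.write a i e) s (s.setArr a (i.eval s) (e.eval s)) (i.cost + e.cost + 1)
  | seq {p q : Prog} {s s' s'' : State} {t t' : ℕ} :
      Exec p s s' t → Exec q s' s'' t' → Exec (.seq p q) s s'' (t + t')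
  | cond_true {e : Expr} {p q : Prog} {s s' : State} {t : ℕ} :
      e.eval s ≠ 0 → Exec p s s' t → Exec (.cond e p q) s s' (e.cost + 1 + t)
  | cond_false {e : Expr} {p q : Prog} {s s' : State} {t : ℕ} :
      e.eval s = 0 → Exec q s s' t → Exec (.cond e p q) s s' (e.cost + 1 + t)
  | loop_true {e : Expr} {p : Prog} {s s' s'' : State} {t t' : ℕ} :
      e.eval s ≠ 0 → Exec p s s' t → Exec (.loop e p) s' s'' t' →
        Exec (.loop e p) s s'' (e.cost + 1 + t + t')
  | loop_false {e : Expr} {p : Prog} {s : State} :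
      e.eval s = 0 → Exec (.loop e p) s s (e.cost + 1)

open Classical in
/-- The input: variable `0` holds the number `n` of vertices, array `0` holds the adjacency matrix
row by row, and everything else is zero. -/
noncomputable def input {n : ℕ} (G : SimpleGraph (Fin n)) : State where
  var x := if x = 0 then n else 0
  arr a i := if a = 0 ∧ ∃ u v : Fin n, G.Adj u v ∧ i = u * n + v then 1 else 0

/-- The state `s` holds a box representation of `G` of dimension `d`: variable `0` holds `d`, and
cell `i * n + v` of array `1` (array `2`) holds the left (right) end point of the interval of the
vertex `v` in the `i`-th interval graph. -/
def HoldsBoxRepresentation {n : ℕ} (G : SimpleGraph (Fin n)) (s : State) (d : ℕ) : Prop :=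
  s.var 0 = d ∧
  (∀ (i : Fin d) (v : Fin n), s.arr 1 (i * n + v) ≤ s.arr 2 (i * n + v)) ∧
  IsBoxRepresentation G fun i : Fin d =>
    intervalGraph (fun v : Fin n => (s.arr 1 (i * n + v) : ℝ))
      (fun v : Fin n => (s.arr 2 (i * n + v) : ℝ))

/-- The state `s` holds a cube representation of `G` of dimension `d`: variable `0` holds `d`, and
the left end point of the unit interval of the vertex `v` in the `i`-th unit interval graph is the
rational number whose numerator is in cell `i * n + v` of array `1` and whose (positive)
denominator is in cell `i` of array `2`. -/
def HoldsCubeRepresentation {n : ℕ} (G : SimpleGraph (Fin n)) (s : State) (d : ℕ) : Prop :=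
  s.var 0 = d ∧
  (∀ i : Fin d, 0 < s.arr 2 i) ∧
  IsCubeRepresentation G fun i : Fin d =>
    intervalGraph (fun v : Fin n => (s.arr 1 (i * n + v) : ℝ) / (s.arr 2 i : ℝ))
      (fun v : Fin n => (s.arr 1 (i * n + v) : ℝ) / (s.arr 2 i : ℝ) + 1)

end Boxicity

/-!
A labelling `l` of the vertices by natural numbers, together with the largest label `reach v` on
the closed neighbourhood of `v`, gives the interval supergraph of `G` with the intervals
`[l v, reach v]`, which separates nonadjacent `u` and `v` whenever `reach v < l u`. Conversely, the
left end points of a box representation, and its negated right end points, may be replaced by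
their ranks within a block of vertices, so that `2 * box G` labellings with ranks as labels separate
each vertex of the block from all its non-neighbours.

For blocks of `k ≈ √(log n / log log n)` vertices, a family of at most `k` such labellings is coded
by fewer than `(n + 1) ^ 20` numbers, so an optimal family is found by brute force in polynomial
time, block by block. This gives `2 * box G` interval graphs for each of about `n / k` blocks. For
unit intervals, each interval graph is replaced by `2 * (log₂ k + 1)` unit interval graphs, one for
each value of each binary digit of the position in the block; this is the additional factor
`log log n`. The finitely many `n` for which the estimates fail are treated by a table of optimal
representations.
-/

namespace Boxicity

/-! ### Timed programs -/

/-- Started in the state `s`, the program `p` halts within `T` steps in a state satisfying `Q`. -/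
def Runs (p : Prog) (T : ℕ) (s : State) (Q : State → Prop) : Prop :=
  ∃ s' t, Exec p s s' t ∧ t ≤ T ∧ Q s'

section Runs

variable {p q : Prog} {T U : ℕ} {s : State} {P Q : State → Prop}

lemma Runs.mono (h : Runs p T s P) (hT : T ≤ U) (hPQ : ∀ s', P s' → Q s') : Runs p U s Q := by
  obtain ⟨s', t, hp, ht, hP⟩ := h
  exact ⟨s', t, hp, ht.trans hT, hPQ s' hP⟩

lemma Runs.seq (hp : Runs p T s P) (hq : ∀ s', P s' → Runs q U s' Q) :
    Runs (.seq p q) (T + U) s Q := by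
  obtain ⟨s', t, hp, ht, hP⟩ := hp
  obtain ⟨s'', t', hq, ht', hQ⟩ := hq s' hP
  exact ⟨s'', t + t', .seq hp hq, add_le_add ht ht', hQ⟩

lemma Runs.assign {x : ℕ} {e : Expr} (h : Q (s.setVar x (e.eval s))) :
    Runs (.assign x e) (e.cost + 1) s Q :=
  ⟨_, _, .assign x e s, le_rfl, h⟩

lemma Runs.write {a : ℕ} {i e : Expr} (h : Q (s.setArr a (i.eval s) (e.eval s))) :
    Runs (.write a i e) (i.cost + e.cost + 1) s Q :=
  ⟨_, _, .write a i e s, le_rfl, h⟩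

lemma Runs.countingLoop {x y m c : ℕ} {I : ℕ → State → Prop}
    (hI : ∀ i s, I i s → s.var x = i ∧ s.var y = m)
    (hp : ∀ i < m, ∀ s, I i s → Runs p c s (I (i + 1))) (h₀ : I 0 s) :
    Runs (.loop (.sub (.var y) (.var x)) p) (m * (c + 4) + 4) s (I m) := by
  suffices key : ∀ j i, i + j = m → ∀ s, I i s →
      Runs (.loop (.sub (.var y) (.var x)) p) (j * (c + 4) + 4) s (I m) from
    key m 0 (zero_add m) s h₀
  intro j
  induction j with
  | zero =>
    rintro i rfl s hs
    obtain ⟨hx, hy⟩ := hI i s hs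
    exact ⟨s, _, .loop_false (by simp [Expr.eval, hx, hy]), by simp [Expr.cost], hs⟩
  | succ j ih =>
    intro i hij s hs
    obtain ⟨hx, hy⟩ := hI i s hs
    obtain ⟨s', t, h, ht, hs'⟩ := hp i (by omega) s hs
    obtain ⟨s'', t', h', ht', hs''⟩ := ih (i + 1) (by omega) s' hs'
    refine ⟨s'', _, .loop_true ?_ h h', ?_, hs''⟩
    · simp only [Expr.eval, hx, hy]
      omega
    · simp only [Expr.cost, Nat.succ_mul]
      omega

end Runs

@[simp] lemma setVar_var_self (s : State) (x m : ℕ) : (s.setVar x m).var x = m :=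
  Function.update_self _ _ _

lemma setVar_var_of_ne (s : State) {x y : ℕ} (m : ℕ) (h : y ≠ x) :
    (s.setVar x m).var y = s.var y :=
  Function.update_of_ne h _ _

/-- The states `s` and `s'` agree on all arrays and on the variables below `b`. -/
def Agree (b : ℕ) (s s' : State) : Prop := s'.arr = s.arr ∧ ∀ x < b, s'.var x = s.var x

lemma Agree.refl (b : ℕ) (s : State) : Agree b s s := ⟨rfl, fun _ _ => rfl⟩

lemma Agree.trans {b : ℕ} {s s' s'' : State} (h : Agree b s s') (h' : Agree b s' s'') :
    Agree b s s'' :=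
  ⟨h'.1.trans h.1, fun x hx => (h'.2 x hx).trans (h.2 x hx)⟩

lemma Agree.mono {b c : ℕ} {s s' : State} (h : Agree c s s') (hb : b ≤ c) : Agree b s s' :=
  ⟨h.1, fun x hx => h.2 x (hx.trans_le hb)⟩

lemma agree_setVar {b x : ℕ} (s : State) (m : ℕ) (h : b ≤ x) : Agree b s (s.setVar x m) :=
  ⟨rfl, fun _ hy => setVar_var_of_ne s m (hy.trans_le h).ne⟩

/-! ### Contexts -/

/-- A finite graph on an initial segment of the natural numbers. -/
abbrev FinGraph := Σ n : ℕ, SimpleGraph (Fin n)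

/-- The graph `D`, with isolated vertices added, as a graph on all natural numbers. -/
abbrev FinGraph.natGraph (D : FinGraph) : SimpleGraph ℕ := D.2.map Fin.valEmbedding

/-- The arguments of a computation: a graph together with finitely many numbers. Functions of
several numbers are functions on iterated products `α × ℕ`. -/
class Context (α : Type) where
  /-- how many numbers there are -/
  depth : ℕ
  /-- the graph -/
  base : α → FinGraph
  /-- the numbers -/
  coord : α → ℕ → ℕ

open Context

instance : Context FinGraph where
  depth := 0
  base D := D
  coord _ _ := 0

instance {α : Type} [Context α] : Context (α × ℕ) where
  depth := depth α + 1
  base x := base x.1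
  coord x i := if i < depth α then coord x.1 i else x.2

section Contexts

variable {α : Type} [Context α]

/-- The number of vertices of the graph of a context. -/
def order (a : α) : ℕ := (base a).1

/-- The size of a context, in which running times are measured: the sum of the order of its graph
and of its numbers. -/
def size (a : α) : ℕ := order a + ∑ i ∈ Finset.range (depth α), coord a i

@[simp] lemma size_finGraph (D : FinGraph) : size D = D.1 :=
  add_eq_left.2 (Finset.sum_range_zero _)

@[simp] lemma size_prod (x : α × ℕ) : size x = size x.1 + x.2 := by
  change order x.1 + ∑ i ∈ Finset.range (depth α + 1), (if i < depth α then coord x.1 i else x.2)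
    = order x.1 + ∑ i ∈ Finset.range (depth α), coord x.1 i + x.2
  rw [Finset.sum_range_succ, if_neg (lt_irrefl _), add_assoc]
  congr 2
  exact Finset.sum_congr rfl fun i hi => if_pos (Finset.mem_range.1 hi)

lemma order_le_size (a : α) : order a ≤ size a := Nat.le_add_right _ _

/-- The state `s` holds the context `a`, whose `i`-th number is in variable `ρ i`. -/
structure Holds (a : α) (ρ : ℕ → ℕ) (s : State) : Prop where
  var_zero : s.var 0 = order a
  arr_zero : s.arr 0 = (input (base a).2).arr 0
  var_coord : ∀ i < depth α, s.var (ρ i) = coord a i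

/-- The layout `ρ` keeps contexts of type `α` in the variables below `b`. -/
def Below (α : Type) [Context α] (ρ : ℕ → ℕ) (b : ℕ) : Prop := 0 < b ∧ ∀ i < depth α, ρ i < b

lemma below_finGraph (ρ : ℕ → ℕ) (b : ℕ) : Below FinGraph ρ (b + 1) :=
  ⟨b.succ_pos, fun i hi => absurd hi i.not_lt_zero⟩

lemma holds_input (D : FinGraph) (ρ : ℕ → ℕ) : Holds D ρ (input D.2) :=
  ⟨rfl, rfl, fun i hi => absurd hi i.not_lt_zero⟩

lemma Holds.agree {a : α} {ρ : ℕ → ℕ} {b : ℕ} {s s' : State} (h : Holds a ρ s)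
    (hρ : Below α ρ b) (hs : Agree b s s') : Holds a ρ s' where
  var_zero := (hs.2 0 hρ.1).trans h.var_zero
  arr_zero := by rw [hs.1, h.arr_zero]
  var_coord i hi := (hs.2 _ (hρ.2 i hi)).trans (h.var_coord i hi)

lemma Below.mono {ρ : ℕ → ℕ} {b c : ℕ} (h : Below α ρ b) (hb : b ≤ c) : Below α ρ c :=
  ⟨h.1.trans_le hb, fun i hi => (h.2 i hi).trans_le hb⟩

lemma Below.fst {ρ : ℕ → ℕ} {b : ℕ} (h : Below (α × ℕ) ρ b) : Below α ρ b :=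
  ⟨h.1, fun i hi => h.2 i (Nat.lt_succ_of_lt hi)⟩

lemma Below.extend {ρ : ℕ → ℕ} {b c y : ℕ} (h : Below α ρ b) (hb : b ≤ c) (hy : y < c) :
    Below (α × ℕ) (Function.update ρ (depth α) y) c := by
  refine ⟨h.1.trans_le hb, fun i hi => ?_⟩
  rcases Nat.lt_succ_iff_lt_or_eq.1 hi with hi | rfl
  · rw [Function.update_of_ne hi.ne]
    exact (h.2 i hi).trans_le hb
  · rwa [Function.update_self]

lemma Holds.fst {x : α × ℕ} {ρ : ℕ → ℕ} {s : State} (h : Holds x ρ s) : Holds x.1 ρ s where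
  var_zero := h.var_zero
  arr_zero := h.arr_zero
  var_coord i hi := (h.var_coord i (Nat.lt_succ_of_lt hi)).trans (if_pos hi)

lemma Holds.snd {x : α × ℕ} {ρ : ℕ → ℕ} {s : State} (h : Holds x ρ s) :
    s.var (ρ (depth α)) = x.2 :=
  (h.var_coord (depth α) (Nat.lt_succ_self _)).trans (if_neg (lt_irrefl _))

lemma Holds.extend {a : α} {ρ : ℕ → ℕ} {s : State} (h : Holds a ρ s) {y m : ℕ}
    (hy : s.var y = m) : Holds (a, m) (Function.update ρ (depth α) y) s where
  var_zero := h.var_zero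
  arr_zero := h.arr_zero
  var_coord i hi := by
    change _ = if i < depth α then coord a i else m
    rcases Nat.lt_succ_iff_lt_or_eq.1 hi with hi | rfl
    · rw [Function.update_of_ne hi.ne, if_pos hi, h.var_coord i hi]
    · rw [Function.update_self, if_neg (lt_irrefl _), hy]

end Contexts

/-! ### Functions computable in polynomial time -/

section PolyTime

variable {α : Type} [Context α] {f g : α → ℕ}

lemma polynomial_eval_mono (T : Polynomial ℕ) : Monotone fun x => T.eval x := by
  intro x y h
  simp only [Polynomial.eval_eq_sum, Polynomial.sum]
  gcongr

/-- `f` is bounded by a polynomial in the size of the context. -/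
def PolyBounded (f : α → ℕ) : Prop := ∃ T : Polynomial ℕ, ∀ a, f a ≤ T.eval (size a)

lemma PolyBounded.add (hf : PolyBounded f) (hg : PolyBounded g) :
    PolyBounded fun a => f a + g a := by
  obtain ⟨T, hT⟩ := hf
  obtain ⟨U, hU⟩ := hg
  exact ⟨T + U, fun a => by rw [Polynomial.eval_add]; exact add_le_add (hT a) (hU a)⟩

lemma PolyBounded.mul (hf : PolyBounded f) (hg : PolyBounded g) :
    PolyBounded fun a => f a * g a := by
  obtain ⟨T, hT⟩ := hf
  obtain ⟨U, hU⟩ := hg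
  exact ⟨T * U, fun a => by rw [Polynomial.eval_mul]; exact Nat.mul_le_mul (hT a) (hU a)⟩

lemma PolyBounded.mono (hg : PolyBounded g) (h : ∀ a, f a ≤ g a) : PolyBounded f :=
  hg.imp fun _ hT a => (h a).trans (hT a)

lemma polyBounded_const (c : ℕ) : PolyBounded fun _ : α => c :=
  ⟨Polynomial.C c, fun a => by simp⟩

lemma polyBounded_size : PolyBounded fun a : α => size a :=
  ⟨Polynomial.X, fun a => by simp⟩

lemma PolyBounded.eval (hf : PolyBounded f) (T : Polynomial ℕ) :
    PolyBounded fun a => T.eval (f a) := by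
  obtain ⟨U, hU⟩ := hf
  exact ⟨T.comp U, fun a => by rw [Polynomial.eval_comp]; exact polynomial_eval_mono T (hU a)⟩

/-- Running `p` on a context laid out by `ρ` puts the value of `f` into variable `b` in time `T`,
and changes neither an array nor a variable below `b`. -/
def Computes (p : Prog) (ρ : ℕ → ℕ) (b : ℕ) (f : α → ℕ) (T : α → ℕ) : Prop :=
  ∀ a s, Holds a ρ s → Runs p (T a) s fun s' => Agree b s s' ∧ s'.var b = f a

/-- The function `f` is bounded by a polynomial and can be computed in polynomial time. -/
def PolyTime (f : α → ℕ) : Prop :=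
  PolyBounded f ∧ ∃ T : α → ℕ, PolyBounded T ∧ ∀ ρ b, Below α ρ b → ∃ p, Computes p ρ b f T

lemma polyTime_of_expr (hf : PolyBounded f) (c : ℕ) (e : (ℕ → ℕ) → Expr)
    (hc : ∀ ρ, (e ρ).cost = c) (he : ∀ (a : α) ρ s, Holds a ρ s → (e ρ).eval s = f a) :
    PolyTime f := by
  refine ⟨hf, fun _ => c + 1, polyBounded_const _, fun ρ b _ =>
    ⟨.assign b (e ρ), fun a s hs => ?_⟩⟩
  rw [← hc ρ]
  exact .assign ⟨agree_setVar _ _ le_rfl, (setVar_var_self _ _ _).trans (he a ρ s hs)⟩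

lemma PolyTime.const (c : ℕ) : PolyTime fun _ : α => c :=
  polyTime_of_expr (polyBounded_const c) 1 (fun _ => .const c) (fun _ => rfl) fun _ _ _ _ => rfl

lemma polyTime_order : PolyTime fun a : α => order a :=
  polyTime_of_expr (polyBounded_size.mono order_le_size) 1 (fun _ => .var 0) (fun _ => rfl)
    fun _ _ _ h => h.var_zero

lemma PolyTime.snd : PolyTime fun x : α × ℕ => x.2 :=
  polyTime_of_expr (polyBounded_size.mono fun x => by simp) 1 (fun ρ => .var (ρ (depth α)))
    (fun _ => rfl) fun _ _ _ h => h.snd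

lemma PolyBounded.fst (hf : PolyBounded f) : PolyBounded fun x : α × ℕ => f x.1 := by
  obtain ⟨T, hT⟩ := hf
  exact ⟨T, fun x => (hT x.1).trans (polynomial_eval_mono T (by simp))⟩

lemma PolyTime.fst (hf : PolyTime f) : PolyTime fun x : α × ℕ => f x.1 := by
  obtain ⟨hfb, T, hT, hf⟩ := hf
  refine ⟨hfb.fst, fun x => T x.1, hT.fst, fun ρ b hρ => ?_⟩
  obtain ⟨p, hp⟩ := hf ρ b hρ.fst
  exact ⟨p, fun x s hs => hp x.1 s hs.fst⟩

lemma PolyTime.congr (hf : PolyTime f) (h : ∀ a, f a = g a) : PolyTime g := by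
  rwa [← funext h]

lemma PolyTime.binary {h : α → ℕ} (hf : PolyTime f) (hg : PolyTime g) (hh : PolyBounded h) (c : ℕ)
    (e : ℕ → Expr) (hc : ∀ b, (e b).cost = c)
    (he : ∀ a b s, s.var b = f a → s.var (b + 1) = g a → s.arr 0 = (input (base a).2).arr 0 →
      (e b).eval s = h a) : PolyTime h := by
  obtain ⟨-, T, hT, hf⟩ := hf
  obtain ⟨-, U, hU, hg⟩ := hg
  refine ⟨hh, fun a => T a + (U a + (c + 1)), hT.add (hU.add (polyBounded_const _)),
    fun ρ b hρ => ?_⟩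
  obtain ⟨p, hp⟩ := hf ρ b hρ
  obtain ⟨q, hq⟩ := hg ρ (b + 1) (hρ.mono b.le_succ)
  refine ⟨.seq p (.seq q (.assign b (e b))), fun a s hs => (hp a s hs).seq fun s₁ h₁ =>
    (hq a s₁ (hs.agree hρ h₁.1)).seq fun s₂ h₂ => ?_⟩
  have hagree := h₁.1.trans (h₂.1.mono b.le_succ)
  rw [← hc b]
  refine .assign ⟨hagree.trans (agree_setVar _ _ le_rfl), ?_⟩
  rw [setVar_var_self]
  exact he a b s₂ ((h₂.1.2 b b.lt_succ_self).trans h₁.2) h₂.2 (hs.agree hρ hagree).arr_zero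

lemma PolyTime.add (hf : PolyTime f) (hg : PolyTime g) : PolyTime fun a => f a + g a :=
  hf.binary hg (hf.1.add hg.1) 3 (fun b => .add (.var b) (.var (b + 1))) (fun _ => rfl)
    fun a b s h₁ h₂ _ => by simp only [Expr.eval, h₁, h₂]

lemma PolyTime.sub (hf : PolyTime f) (hg : PolyTime g) : PolyTime fun a => f a - g a :=
  hf.binary hg (hf.1.mono fun _ => Nat.sub_le _ _) 3 (fun b => .sub (.var b) (.var (b + 1)))
    (fun _ => rfl) fun a b s h₁ h₂ _ => by simp only [Expr.eval, h₁, h₂]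

lemma PolyTime.input (hf : PolyTime f) : PolyTime fun a => (input (base a).2).arr 0 (f a) := by
  refine hf.binary hf ((polyBounded_const 1).mono fun a => ?_) 2 (fun b => .read 0 (.var b))
    (fun _ => rfl) fun a b s h₁ _ h₂ => by simp only [Expr.eval, h₁, h₂]
  simp only [Boxicity.input]
  split_ifs <;> simp

/-- The body of the loop carrying out a bounded recursion whose step is computed by `p`: the current
value is in variable `b`, the index in variable `b + 1`, and `p` leaves its result in variable
`b + 3`. -/
def recursionBody (p : Prog) (b : ℕ) : Prog :=
  .seq p (.seq (.assign b (.var (b + 3))) (.assign (b + 1) (.add (.var (b + 1)) (.const 1))))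

lemma runs_recursionBody {F : α → ℕ → ℕ} {φ : (α × ℕ) × ℕ → ℕ} {T : (α × ℕ) × ℕ → ℕ} {p : Prog}
    {ρ : ℕ → ℕ} {b i m : ℕ} {a : α} {s₀ s : State} (hρ : Below α ρ b) (h₀ : Holds a ρ s₀)
    (hp : Computes p (Function.update (Function.update ρ (depth α) (b + 1)) (depth α + 1) b)
      (b + 3) φ T)
    (hF : F a (i + 1) = φ ((a, i), F a i))
    (hs : Agree b s₀ s ∧ s.var b = F a i ∧ s.var (b + 1) = i ∧ s.var (b + 2) = m) :
    Runs (recursionBody p b) (T ((a, i), F a i) + 6) s fun s' =>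
      Agree b s₀ s' ∧ s'.var b = F a (i + 1) ∧ s'.var (b + 1) = i + 1 ∧ s'.var (b + 2) = m := by
  obtain ⟨hs, hb, hb₁, hb₂⟩ := hs
  refine (hp ((a, i), F a i) s (((h₀.agree hρ hs).extend hb₁).extend hb)).seq fun s₁ h₁ =>
    Runs.seq (.assign rfl) ?_ (U := 4)
  rintro s₂ rfl
  refine .assign ⟨?_, ?_, ?_, ?_⟩
  · exact ((hs.trans (h₁.1.mono (by omega))).trans (agree_setVar _ _ le_rfl)).trans
      (agree_setVar _ _ b.le_succ)
  · rw [setVar_var_of_ne _ _ (by omega), setVar_var_self, hF, ← h₁.2]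
    rfl
  · simp only [setVar_var_self, Expr.eval]
    rw [setVar_var_of_ne _ _ (by omega), h₁.1.2 _ (by omega), hb₁]
  · rw [setVar_var_of_ne _ _ (by omega), setVar_var_of_ne _ _ (by omega), h₁.1.2 _ (by omega), hb₂]

lemma runs_recursionLoop {F : α → ℕ → ℕ} {φ : (α × ℕ) × ℕ → ℕ} {T : (α × ℕ) × ℕ → ℕ} {p : Prog}
    {ρ : ℕ → ℕ} {b m c : ℕ} {a : α} {s : State} (hρ : Below α ρ b) (hs : Holds a ρ s)
    (hp : Computes p (Function.update (Function.update ρ (depth α) (b + 1)) (depth α + 1) b)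
      (b + 3) φ T)
    (hF : ∀ i, F a (i + 1) = φ ((a, i), F a i)) (hc : ∀ i < m, T ((a, i), F a i) ≤ c)
    (hb : s.var b = F a 0) (hb₁ : s.var (b + 1) = 0) (hb₂ : s.var (b + 2) = m) :
    Runs (.loop (.sub (.var (b + 2)) (.var (b + 1))) (recursionBody p b)) (m * (c + 10) + 4) s
      fun s' => Agree b s s' ∧ s'.var b = F a m := by
  let I (i : ℕ) (s' : State) : Prop :=
    Agree b s s' ∧ s'.var b = F a i ∧ s'.var (b + 1) = i ∧ s'.var (b + 2) = m
  have hstep : ∀ i < m, ∀ s', I i s' → Runs (recursionBody p b) (c + 6) s' (I (i + 1)) :=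
    fun i hi s' hs' => (runs_recursionBody hρ hs hp (hF i) hs').mono
      (Nat.add_le_add_right (hc i hi) 6) fun _ h => h
  exact (Runs.countingLoop (I := I) (fun i s' h => h.2.2) hstep
    ⟨Agree.refl b s, hb, hb₁, hb₂⟩).mono le_rfl fun s' h => ⟨h.1, h.2.1⟩

lemma PolyTime.recursion {F : α → ℕ → ℕ} {φ : (α × ℕ) × ℕ → ℕ} {m B : α → ℕ}
    (h₀ : PolyTime fun a => F a 0) (hφ : PolyTime φ) (hF : ∀ a i, F a (i + 1) = φ ((a, i), F a i))
    (hm : PolyTime m) (hB : PolyBounded B) (hFB : ∀ a, ∀ i ≤ m a, F a i ≤ B a) :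
    PolyTime fun a => F a (m a) := by
  obtain ⟨-, T₀, hT₀, h₀⟩ := h₀
  obtain ⟨hmb, T₁, hT₁, hm⟩ := hm
  obtain ⟨-, T₂, ⟨W, hW⟩, hφ⟩ := hφ
  set c : α → ℕ := fun a => W.eval (size a + m a + B a)
  have hcb : PolyBounded c := ((polyBounded_size.add hmb).add hB).eval W
  have hc : ∀ a, ∀ i < m a, T₂ ((a, i), F a i) ≤ c a := fun a i hi =>
    (hW _).trans <| polynomial_eval_mono W <| by
      simp only [size_prod]
      exact add_le_add (by omega) (hFB a i hi.le)
  refine ⟨hB.mono fun a => hFB a (m a) le_rfl,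
    fun a => T₀ a + (T₁ a + (2 + (m a * (c a + 10) + 4))),
    hT₀.add (hT₁.add ((polyBounded_const 2).add ((hmb.mul (hcb.add (polyBounded_const 10))).add
      (polyBounded_const 4)))), fun ρ b hρ => ?_⟩
  obtain ⟨p₀, h₀⟩ := h₀ ρ b hρ
  obtain ⟨p₁, h₁⟩ := hm ρ (b + 2) (hρ.mono (by omega))
  obtain ⟨p₂, h₂⟩ := hφ _ (b + 3) <|
    (hρ.extend (by omega : b ≤ b + 2) (b + 1).lt_succ_self).extend (by omega) (by omega : b < b + 3)
  refine ⟨.seq p₀ (.seq p₁ (.seq (.assign (b + 1) (.const 0))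
    (.loop (.sub (.var (b + 2)) (.var (b + 1))) (recursionBody p₂ b)))), fun a s hs =>
    (h₀ a s hs).seq fun s₁ hs₁ => (h₁ a s₁ (hs.agree hρ hs₁.1)).seq fun s₂ hs₂ =>
      Runs.seq (.assign rfl) ?_ (U := m a * (c a + 10) + 4)⟩
  rintro s₃ rfl
  have hagree : Agree b s (s₂.setVar (b + 1) 0) :=
    (hs₁.1.trans (hs₂.1.mono (by omega))).trans (agree_setVar _ _ b.le_succ)
  refine (runs_recursionLoop hρ (hs.agree hρ hagree) h₂ (hF a) (hc a) ?_ (setVar_var_self _ _ _)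
    ?_).mono le_rfl fun s' h => ⟨hagree.trans h.1, h.2⟩
  · rw [setVar_var_of_ne _ _ (by omega), hs₂.1.2 _ (by omega), hs₁.2]
  · rw [setVar_var_of_ne _ _ (by omega), hs₂.2]

lemma PolyTime.mul (hf : PolyTime f) (hg : PolyTime g) : PolyTime fun a => f a * g a :=
  .recursion (F := fun a i => i * g a) (φ := fun x => x.2 + g x.1.1)
    ((PolyTime.const 0).congr fun _ => (zero_mul _).symm) (.add .snd hg.fst.fst)
    (fun a i => Nat.succ_mul i (g a)) hf (hf.1.mul hg.1) fun _ _ hi => Nat.mul_le_mul_right _ hi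

lemma PolyTime.sum {m : α → ℕ} {f : α → ℕ → ℕ} (hm : PolyTime m)
    (hf : PolyTime fun x : α × ℕ => f x.1 x.2) :
    PolyTime fun a => ∑ i ∈ Finset.range (m a), f a i := by
  obtain ⟨U, hU⟩ := hf.1
  refine .recursion (F := fun a i => ∑ j ∈ Finset.range i, f a j)
    (φ := fun x => x.2 + f x.1.1 x.1.2) ((PolyTime.const 0).congr fun _ => rfl) (.add .snd hf.fst)
    (fun a i => Finset.sum_range_succ (f a) i) hm
    (hm.1.mul ((polyBounded_size.add hm.1).eval U)) fun a i hi => ?_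
  have hterm : ∀ j ∈ Finset.range i, f a j ≤ U.eval (size a + m a) := fun j hj =>
    (hU (a, j)).trans <| polynomial_eval_mono U <| by
      have := Finset.mem_range.1 hj
      simp only [size_prod]
      omega
  refine (Finset.sum_le_card_nsmul _ _ _ hterm).trans ?_
  rw [Finset.card_range, smul_eq_mul]
  exact Nat.mul_le_mul_right _ hi

lemma PolyTime.pow_const (hf : PolyTime f) (c : ℕ) : PolyTime fun a => f a ^ c := by
  induction c with
  | zero => simpa only [pow_zero] using PolyTime.const 1
  | succ c ih => simpa only [pow_succ] using ih.mul hf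

lemma PolyTime.min (hf : PolyTime f) (hg : PolyTime g) : PolyTime fun a => min (f a) (g a) :=
  (hf.sub (hf.sub hg)).congr fun a => by omega

lemma PolyTime.max (hf : PolyTime f) (hg : PolyTime g) : PolyTime fun a => max (f a) (g a) :=
  (hf.add (hg.sub hf)).congr fun a => by omega

lemma PolyTime.sup {m : α → ℕ} {f : α → ℕ → ℕ} (hm : PolyTime m)
    (hf : PolyTime fun x : α × ℕ => f x.1 x.2) :
    PolyTime fun a => (Finset.range (m a)).sup (f a) := by
  obtain ⟨U, hU⟩ := hf.1
  refine .recursion (F := fun a i => (Finset.range i).sup (f a))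
    (φ := fun x => Max.max (f x.1.1 x.1.2) x.2) ((PolyTime.const 0).congr fun _ => rfl)
    (.max hf.fst .snd) (fun _ _ => by rw [Finset.range_add_one, Finset.sup_insert]) hm
    ((polyBounded_size.add hm.1).eval U) fun a i hi => Finset.sup_le fun j hj =>
    (hU (a, j)).trans <| polynomial_eval_mono U <| by
      have := Finset.mem_range.1 hj
      simp only [size_prod]
      omega

end PolyTime

/-! ### Predicates decidable in polynomial time -/

section PolyTimePred

variable {α : Type} [Context α] {f g h : α → ℕ} {P Q : α → Prop}

open Classical in
/-- The predicate `P` can be decided in polynomial time. -/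
def PolyTimePred (P : α → Prop) : Prop := PolyTime fun a => if P a then 1 else 0

lemma PolyTimePred.congr (hP : PolyTimePred P) (h : ∀ a, P a ↔ Q a) : PolyTimePred Q := by
  rwa [← funext fun a => propext (h a)]

lemma PolyTime.ne_zero (hf : PolyTime f) : PolyTimePred fun a => f a ≠ 0 :=
  ((PolyTime.const 1).sub ((PolyTime.const 1).sub hf)).congr fun a => by split_ifs <;> omega

lemma PolyTimePred.fst (hP : PolyTimePred P) : PolyTimePred fun x : α × ℕ => P x.1 :=
  PolyTime.fst hP

lemma PolyTimePred.not (hP : PolyTimePred P) : PolyTimePred fun a => ¬ P a :=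
  ((PolyTime.const 1).sub hP).congr fun a => by by_cases h : P a <;> simp [h]

lemma PolyTimePred.and (hP : PolyTimePred P) (hQ : PolyTimePred Q) :
    PolyTimePred fun a => P a ∧ Q a :=
  (PolyTime.mul hP hQ).congr fun a => by by_cases h : P a <;> by_cases h' : Q a <;> simp [h, h']

lemma PolyTimePred.or (hP : PolyTimePred P) (hQ : PolyTimePred Q) :
    PolyTimePred fun a => P a ∨ Q a :=
  (hP.not.and hQ.not).not.congr fun a => by tauto

lemma PolyTimePred.imp (hP : PolyTimePred P) (hQ : PolyTimePred Q) :
    PolyTimePred fun a => P a → Q a :=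
  (hP.not.or hQ).congr fun a => by tauto

lemma PolyTime.lt (hf : PolyTime f) (hg : PolyTime g) : PolyTimePred fun a => f a < g a :=
  (hg.sub hf).ne_zero.congr fun a => by omega

lemma PolyTime.le (hf : PolyTime f) (hg : PolyTime g) : PolyTimePred fun a => f a ≤ g a :=
  (hg.lt hf).not.congr fun a => by omega

lemma PolyTime.eq (hf : PolyTime f) (hg : PolyTime g) : PolyTimePred fun a => f a = g a :=
  ((hf.le hg).and (hg.le hf)).congr fun a => by omega

lemma PolyTime.ite [DecidablePred P] (hP : PolyTimePred P) (hf : PolyTime f) (hg : PolyTime g) :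
    PolyTime fun a => if P a then f a else g a :=
  ((PolyTime.mul hP hf).add (((PolyTime.const 1).sub hP).mul hg)).congr fun a => by
    by_cases h : P a <;> simp [h]

lemma PolyTimePred.exists_lt {m : α → ℕ} {P : α → ℕ → Prop} (hm : PolyTime m)
    (hP : PolyTimePred fun x : α × ℕ => P x.1 x.2) : PolyTimePred fun a => ∃ i < m a, P a i := by
  classical
  exact (PolyTime.sum (f := fun a i => if P a i then 1 else 0) hm
    (.ite hP (.const 1) (.const 0))).ne_zero.congr fun a => by simp

lemma PolyTimePred.forall_lt {m : α → ℕ} {P : α → ℕ → Prop} (hm : PolyTime m)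
    (hP : PolyTimePred fun x : α × ℕ => P x.1 x.2) : PolyTimePred fun a => ∀ i < m a, P a i :=
  (PolyTimePred.exists_lt (P := fun a i => ¬ P a i) hm hP.not).not.congr fun a => by
    simp only [not_exists, not_and, not_not]

lemma PolyTime.findGreatest {m : α → ℕ} {P : α → ℕ → Prop} [∀ a, DecidablePred (P a)]
    (hm : PolyTime m) (hP : PolyTimePred fun x : α × ℕ => P x.1 x.2) :
    PolyTime fun a => Nat.findGreatest (P a) (m a) := by
  refine (PolyTime.sup (f := fun a i => if P a i then i else 0) (hm.add (.const 1))
    (.ite hP .snd (.const 0))).congr fun a => ?_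
  induction m a with
  | zero => simp
  | succ i ih =>
    rw [Finset.range_add_one, Finset.sup_insert, ih, Nat.findGreatest_succ]
    split_ifs with h
    · exact max_eq_left ((Nat.findGreatest_le i).trans i.le_succ)
    · exact max_eq_right (Nat.zero_le _)

lemma PolyTime.sInf {m : α → ℕ} {P : α → ℕ → Prop} (hm : PolyTime m)
    (hP : PolyTimePred fun x : α × ℕ => P x.1 x.2) (h : ∀ a, ∃ i ≤ m a, P a i) :
    PolyTime fun a => sInf {i | P a i} := by
  classical
  have hmem : ∀ a, P a (InfSet.sInf {i | P a i}) := fun a =>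
    Nat.sInf_mem (s := {i | P a i}) ((h a).imp fun _ hi => hi.2)
  have hle : ∀ {a i}, P a i → InfSet.sInf {i | P a i} ≤ i := fun hi => Nat.sInf_le hi
  refine (PolyTime.recursion (F := fun a i => Min.min i (InfSet.sInf {i | P a i}))
    (φ := fun x => if x.2 < x.1.2 ∨ P x.1.1 x.1.2 then x.2 else x.1.2 + 1)
    ((PolyTime.const 0).congr fun a => (Nat.zero_min _).symm)
    (.ite ((PolyTime.snd.lt PolyTime.snd.fst).or hP.fst) .snd (PolyTime.snd.fst.add (.const 1)))
    (fun a i => ?_) hm hm.1 fun a i hi => (min_le_left _ _).trans hi).congr fun a => ?_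
  · have hne : ¬ P a i → InfSet.sInf {i | P a i} ≠ i := fun hi heq => hi (heq ▸ hmem a)
    by_cases hi : P a i
    · have := hle hi
      simp only [hi, or_true, if_true]
      omega
    · have := hne hi
      simp only [hi, or_false]
      split_ifs <;> omega
  · obtain ⟨i, hi, hPi⟩ := h a
    exact min_eq_right ((hle hPi).trans hi)

lemma PolyTime.div (hf : PolyTime f) (hg : PolyTime g) : PolyTime fun a => f a / g a := by
  refine (PolyTime.ite (hg.eq (.const 0)) (.const 0) (PolyTime.findGreatest
    (P := fun a i => i * g a ≤ f a) hf ((PolyTime.snd.mul hg.fst).le hf.fst))).congr fun a => ?_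
  split_ifs with hg₀
  · rw [hg₀, Nat.div_zero]
  · have hpos : 0 < g a := Nat.pos_of_ne_zero hg₀
    refine le_antisymm ((Nat.le_div_iff_mul_le hpos).2 ?_)
      (Nat.le_findGreatest (Nat.div_le_self _ _) (Nat.div_mul_le_self _ _))
    exact Nat.findGreatest_spec (P := fun i => i * g a ≤ f a) (Nat.zero_le _) (by simp)

lemma PolyTime.mod (hf : PolyTime f) (hg : PolyTime g) : PolyTime fun a => f a % g a :=
  (hf.sub (hg.mul (hf.div hg))).congr fun a => by
    have := Nat.div_add_mod (f a) (g a)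
    omega

/-- The cap keeps the intermediate values polynomially bounded. -/
lemma PolyTime.min_pow (hf : PolyTime f) (hg : PolyTime g) (hh : PolyTime h) :
    PolyTime fun a => Min.min (f a) (g a ^ h a) := by
  refine .recursion (F := fun a i => Min.min (f a) (g a ^ i))
    (φ := fun x => Min.min (f x.1.1) (x.2 * g x.1.1)) (hf.min (.const 1))
    (hf.fst.fst.min (.mul .snd hg.fst.fst)) (fun a i => ?_) hh hf.1 fun _ _ _ => min_le_left _ _
  rcases (g a).eq_zero_or_pos with hg₀ | hg₀
  · simp [hg₀]
  rcases le_total (f a) (g a ^ i) with hle | hle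
  · have hmul : f a ≤ f a * g a := Nat.le_mul_of_pos_right _ hg₀
    rw [min_eq_left hle, min_eq_left hmul, pow_succ,
      min_eq_left (hmul.trans (Nat.mul_le_mul_right _ hle))]
  · rw [min_eq_right hle, pow_succ]

lemma PolyTime.div_pow (hf : PolyTime f) (hg : PolyTime g) (hh : PolyTime h) :
    PolyTime fun a => f a / g a ^ h a := by
  refine (hf.div ((hf.add (.const 1)).min_pow hg hh)).congr fun a => ?_
  rcases le_total (f a + 1) (g a ^ h a) with hle | hle
  · rw [min_eq_left hle, Nat.div_eq_of_lt (f a).lt_succ_self, Nat.div_eq_of_lt hle]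
  · rw [min_eq_right hle]

lemma PolyTime.pow_le (hg : PolyTime g) (hh : PolyTime h) (hf : PolyTime f) :
    PolyTimePred fun a => g a ^ h a ≤ f a :=
  (((hf.add (.const 1)).min_pow hg hh).le hf).congr fun a => by
    rw [min_le_iff, or_iff_right (Nat.not_succ_le_self _)]

lemma PolyTime.log (hf : PolyTime f) {b : ℕ} (hb : 1 < b) : PolyTime fun a => Nat.log b (f a) := by
  refine (PolyTime.findGreatest (P := fun a i => b ^ i ≤ f a) hf
    (.pow_le (.const b) .snd hf.fst)).congr fun a => ?_
  rcases (f a).eq_zero_or_pos with hf₀ | hf₀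
  · rw [hf₀, Nat.log_zero_right, Nat.findGreatest_zero]
  · refine le_antisymm (Nat.le_log_of_pow_le hb ?_)
      (Nat.le_findGreatest (Nat.log_le_self _ _) (Nat.pow_log_le_self _ hf₀.ne'))
    exact Nat.findGreatest_spec (P := fun i => b ^ i ≤ f a) (Nat.zero_le _) hf₀

lemma mul_add_div_of_lt {m n r : ℕ} (h : r < n) : (m * n + r) / n = m := by
  rw [mul_comm, Nat.mul_add_div (r.zero_le.trans_lt h), Nat.div_eq_of_lt h, add_zero]

lemma natGraph_adj_iff (D : FinGraph) (u v : ℕ) :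
    D.natGraph.Adj u v ↔ (u < D.1 ∧ v < D.1) ∧ (input D.2).arr 0 (u * D.1 + v) ≠ 0 := by
  simp only [input, SimpleGraph.map_adj, Fin.valEmbedding_apply, true_and, ne_eq, ite_eq_right_iff,
    one_ne_zero, imp_false, not_not]
  constructor
  · rintro ⟨x, y, h, rfl, rfl⟩
    exact ⟨⟨x.2, y.2⟩, x, y, h, rfl⟩
  · rintro ⟨⟨hu, hv⟩, x, y, h, e⟩
    have hux : u = x := by rw [← mul_add_div_of_lt (m := u) hv, e, mul_add_div_of_lt y.2]
    subst hux
    exact ⟨x, y, h, rfl, by omega⟩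

lemma PolyTimePred.adj (hf : PolyTime f) (hg : PolyTime g) :
    PolyTimePred fun a => (base a).natGraph.Adj (f a) (g a) :=
  (((hf.lt polyTime_order).and (hg.lt polyTime_order)).and
    ((hf.mul polyTime_order).add hg).input.ne_zero).congr fun _ => (natGraph_adj_iff _ _ _).symm

lemma PolyTimePred.forall_mem {ι : Type*} (S : Finset ι) {P : ι → α → Prop}
    (h : ∀ i, PolyTimePred (P i)) : PolyTimePred fun a => ∀ i ∈ S, P i a := by
  classical
  induction S using Finset.induction_on with
  | empty => simpa [PolyTimePred] using PolyTime.const 1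
  | insert i S _ ih => exact ((h i).and ih).congr fun a => by simp

lemma PolyTime.finset_sum {ι : Type*} (S : Finset ι) {f : ι → α → ℕ} (h : ∀ i, PolyTime (f i)) :
    PolyTime fun a => ∑ i ∈ S, f i a := by
  classical
  induction S using Finset.induction_on with
  | empty => simpa using PolyTime.const 0
  | insert i S hi ih => exact ((h i).add ih).congr fun a => by rw [Finset.sum_insert hi]

lemma finGraph_eq_iff (D D' : FinGraph) :
    D = D' ↔ D.1 = D'.1 ∧ ∀ p ∈ Finset.range D'.1 ×ˢ Finset.range D'.1,
      (D.natGraph.Adj p.1 p.2 ↔ D'.natGraph.Adj p.1 p.2) := by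
  constructor
  · rintro rfl
    exact ⟨rfl, fun _ _ => Iff.rfl⟩
  · obtain ⟨n, G⟩ := D
    obtain ⟨n', G'⟩ := D'
    rintro ⟨rfl, hadj⟩
    congr 1
    ext u v
    exact SimpleGraph.map_adj_apply.symm.trans
      ((hadj (u, v) (by simp)).trans SimpleGraph.map_adj_apply)

lemma PolyTimePred.base_eq (D : FinGraph) : PolyTimePred fun a : α => base a = D := by
  have hadj (p : ℕ × ℕ) :
      PolyTimePred fun a : α => ((base a).natGraph.Adj p.1 p.2 ↔ D.natGraph.Adj p.1 p.2) := by
    have := PolyTimePred.adj (α := α) (.const p.1) (.const p.2)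
    by_cases h : D.natGraph.Adj p.1 p.2
    · simpa only [h, iff_true] using this
    · simpa only [h, iff_false] using this.not
  exact ((polyTime_order.eq (.const D.1)).and (PolyTimePred.forall_mem _ hadj)).congr
    fun _ => (finGraph_eq_iff _ _).symm

lemma PolyTime.patch (N m : ℕ) (F : FinGraph × ℕ → ℕ) (hf : PolyTime f) (hg : PolyTime g) :
    PolyTime fun a => if order a < N ∧ g a < m then F (base a, g a) else f a := by
  classical
  let S : Finset (FinGraph × ℕ) :=
    ((Finset.range N).sigma fun _ => Finset.univ) ×ˢ Finset.range m
  have htable : PolyTime fun a => ∑ p ∈ S, if base a = p.1 ∧ g a = p.2 then F p else 0 :=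
    .finset_sum S fun p =>
      .ite ((PolyTimePred.base_eq p.1).and (hg.eq (.const p.2))) (.const (F p)) (.const 0)
  refine (PolyTime.ite ((polyTime_order.lt (.const N)).and (hg.lt (.const m))) htable hf).congr
    fun a => ite_congr rfl (fun h => ?_) fun _ => rfl
  have hmem : (base a, g a) ∈ S := by simpa [S, order] using h
  simp only [← Prod.ext_iff (x := (base a, g a)), Finset.sum_ite_eq, if_pos hmem]

end PolyTimePred

/-! ### Programs that write a table -/

section Output

variable {D : FinGraph} {X Y : FinGraph × ℕ → ℕ} {px py : Prog} {d m : ℕ}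

/-- The body of the loop that writes two tables, whose entries are computed by `px` and `py`, into
the arrays `1` and `2`: the index is in variable `1`. -/
def outputBody (px py : Prog) : Prog :=
  .seq px (.seq py (.seq (.write 1 (.var 1) (.var 4)) (.seq (.write 2 (.var 1) (.var 5))
    (.assign 1 (.add (.var 1) (.const 1))))))

/-- The state after `i` rounds of the loop with body `outputBody`: the index is in variable `1`, the
dimension `d` in variable `2` and the length `m` of the tables in variable `3`. -/
def HoldsOutput (D : FinGraph) (X Y : FinGraph × ℕ → ℕ) (d m i : ℕ) (s : State) : Prop :=
  Holds (D, i) (fun _ => 1) s ∧ s.var 2 = d ∧ s.var 3 = m ∧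
    ∀ x < i, s.arr 1 x = X (D, x) ∧ s.arr 2 x = Y (D, x)

lemma below_prod_finGraph (b : ℕ) : Below (FinGraph × ℕ) (fun _ => 1) (b + 2) :=
  ⟨by omega, fun _ _ => Nat.lt_add_left b one_lt_two⟩

lemma holds_prod_finGraph {i : ℕ} {s : State} (h₀ : s.var 0 = D.1) (h₁ : s.var 1 = i)
    (harr : s.arr 0 = (input D.2).arr 0) : Holds (D, i) (fun _ => 1) s :=
  ⟨h₀, harr, fun j _ => h₁.trans (if_neg j.not_lt_zero).symm⟩

lemma runs_outputBody {T U : FinGraph × ℕ → ℕ} (hX : Computes px (fun _ => 1) 4 X T)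
    (hY : Computes py (fun _ => 1) 5 Y U) {i : ℕ} {s : State} (hs : HoldsOutput D X Y d m i s) :
    Runs (outputBody px py) (T (D, i) + U (D, i) + 10) s (HoldsOutput D X Y d m (i + 1)) := by
  obtain ⟨hs, hd, hm, hcells⟩ := hs
  rw [add_assoc]
  refine (hX _ s hs).seq fun s₁ h₁ => (hY _ s₁ (hs.agree (below_prod_finGraph 2) h₁.1)).seq
    fun s₂ h₂ => Runs.seq (.write rfl) (U := 7) ?_ (T := 3)
  rintro s₃ rfl
  refine Runs.seq (.write rfl) (U := 4) ?_ (T := 3)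
  rintro s₄ rfl
  have hagree : Agree 4 s s₂ := h₁.1.trans (h₂.1.mono (by omega))
  have hv₁ : s₂.var 1 = i := (hagree.2 1 (by omega)).trans hs.snd
  have hv₄ : s₂.var 4 = X (D, i) := (h₂.1.2 4 (by omega)).trans h₁.2
  refine .assign ⟨holds_prod_finGraph ((hagree.2 0 (by omega)).trans hs.var_zero)
    (congrArg (· + 1) hv₁) ((congrFun hagree.1 0).trans hs.arr_zero),
    (hagree.2 2 (by omega)).trans hd, (hagree.2 3 (by omega)).trans hm, fun x hx => ?_⟩
  rcases Nat.lt_succ_iff_lt_or_eq.1 hx with hx | rfl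
  · simpa [State.setVar, State.setArr, Expr.eval, hv₁, hx.ne, hagree.1] using hcells x hx
  · simp [State.setVar, State.setArr, Expr.eval, hv₁, hv₄, h₂.2]

lemma exists_prog_output {d m : FinGraph → ℕ} (hd : PolyTime d) (hm : PolyTime m)
    (hX : PolyTime X) (hY : PolyTime Y) :
    ∃ (p : Prog) (T : Polynomial ℕ), ∀ D : FinGraph, Runs p (T.eval D.1) (input D.2) fun s =>
      s.var 0 = d D ∧ ∀ x < m D, s.arr 1 x = X (D, x) ∧ s.arr 2 x = Y (D, x) := by
  obtain ⟨-, T₁, hT₁, hd⟩ := hd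
  obtain ⟨hmb, T₂, hT₂, hm⟩ := hm
  obtain ⟨-, T₃, ⟨V, hV⟩, hX⟩ := hX
  obtain ⟨-, T₄, ⟨W, hW⟩, hY⟩ := hY
  obtain ⟨p₁, hp₁⟩ := hd _ 2 (below_finGraph (fun _ => 1) 1)
  obtain ⟨p₂, hp₂⟩ := hm _ 3 (below_finGraph (fun _ => 1) 2)
  obtain ⟨p₃, hp₃⟩ := hX _ 4 (below_prod_finGraph 2)
  obtain ⟨p₄, hp₄⟩ := hY _ 5 (below_prod_finGraph 3)
  set c : FinGraph → ℕ := fun D => (V + W).eval (size D + m D)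
  have hc : ∀ D, ∀ i < m D, T₃ (D, i) + T₄ (D, i) ≤ c D := fun D i hi => by
    refine (add_le_add (hV _) (hW _)).trans ?_
    rw [← Polynomial.eval_add]
    exact polynomial_eval_mono (V + W) (by simp only [size_prod]; omega)
  obtain ⟨T, hT⟩ : PolyBounded fun D => T₁ D + (T₂ D + (m D * (c D + 14) + 4 + 2)) :=
    hT₁.add (hT₂.add (((hmb.mul (((polyBounded_size.add hmb).eval _).add
      (polyBounded_const 14))).add (polyBounded_const 4)).add (polyBounded_const 2)))
  refine ⟨.seq p₁ (.seq p₂ (.seq (.loop (.sub (.var 3) (.var 1)) (outputBody p₃ p₄))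
    (.assign 0 (.var 2)))), T, fun D => ?_⟩
  have h₀ := holds_input D fun _ => 1
  refine Runs.mono ((hp₁ D _ h₀).seq fun s₁ h₁ =>
    (hp₂ D s₁ (h₀.agree (below_finGraph _ 1) h₁.1)).seq fun s₂ h₂ => ?_)
    ((hT D).trans_eq (by rw [size_finGraph])) fun _ h => h
  have hagree : Agree 2 (input D.2) s₂ := h₁.1.trans (h₂.1.mono (by omega))
  have hstart : HoldsOutput D X Y (d D) (m D) 0 s₂ :=
    ⟨holds_prod_finGraph (hagree.2 0 two_pos) (hagree.2 1 one_lt_two) (congrFun hagree.1 0),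
      (h₂.1.2 2 (by omega)).trans h₁.2, h₂.2, fun x hx => absurd hx x.not_lt_zero⟩
  refine (Runs.countingLoop (I := HoldsOutput D X Y (d D) (m D)) (c := c D + 10)
    (fun i s hs => ⟨hs.1.snd, hs.2.2.1⟩) (fun i hi s hs => (runs_outputBody hp₃ hp₄ hs).mono
      (Nat.add_le_add_right (hc D i hi) 10) fun _ h => h) hstart).seq fun s₃ h₃ => .assign ⟨?_, ?_⟩
  · rw [setVar_var_self]
    exact h₃.2.1
  · exact h₃.2.2.2

lemma exists_prog_of_eventually {R : FinGraph → ℕ → (ℕ → ℕ) → (ℕ → ℕ) → Prop}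
    (hR : ∀ D d X X' Y Y', (∀ x < d * (D.1 + 1), X x = X' x ∧ Y x = Y' x) →
      R D d X Y → R D d X' Y')
    (hex : ∀ D, ∃ d X Y, R D d X Y) {d : FinGraph → ℕ} (hd : PolyTime d) (hX : PolyTime X)
    (hY : PolyTime Y)
    (hlarge : ∀ᶠ n in Filter.atTop, ∀ G : SimpleGraph (Fin n),
      R ⟨n, G⟩ (d ⟨n, G⟩) (fun x => X (⟨n, G⟩, x)) fun x => Y (⟨n, G⟩, x)) :
    ∃ (p : Prog) (T : Polynomial ℕ), ∀ (n : ℕ) (G : SimpleGraph (Fin n)),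
      Runs p (T.eval n) (input G) fun s => R ⟨n, G⟩ (s.var 0) (s.arr 1) (s.arr 2) := by
  choose d₀ X₀ Y₀ h₀ using hex
  obtain ⟨N, hN⟩ := Filter.eventually_atTop.1 hlarge
  let S : Finset FinGraph := (Finset.range N).sigma fun _ => Finset.univ
  let m : ℕ := S.sup fun D => d₀ D * (D.1 + 1)
  have hd' := PolyTime.patch N 1 (fun x => d₀ x.1) hd (.const 0)
  obtain ⟨p, T, hp⟩ := exists_prog_output hd' (hd'.mul (polyTime_order.add (.const 1)))
    (PolyTime.patch N m (fun x => X₀ x.1 x.2) hX .snd)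
    (PolyTime.patch N m (fun x => Y₀ x.1 x.2) hY .snd)
  refine ⟨p, T, fun n G => (hp ⟨n, G⟩).mono le_rfl fun s ⟨hs₀, hs⟩ => ?_⟩
  rw [← hs₀] at hs
  by_cases hn : n < N
  · have hs₀' : s.var 0 = d₀ ⟨n, G⟩ := hs₀.trans (if_pos ⟨hn, one_pos⟩)
    refine hR _ _ _ _ _ _ (fun x hx => ?_) (hs₀' ▸ h₀ ⟨n, G⟩)
    have hxm : x < m := hx.trans_le <| hs₀' ▸
      Finset.le_sup (f := fun D : FinGraph => d₀ D * (D.1 + 1)) (by simpa [S] using hn)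
    rw [(hs x hx).1, (hs x hx).2]
    exact ⟨(if_pos ⟨hn, hxm⟩).symm, (if_pos ⟨hn, hxm⟩).symm⟩
  · have hs₀' : s.var 0 = d ⟨n, G⟩ := hs₀.trans (if_neg fun h => hn h.1)
    refine hR _ _ _ _ _ _ (fun x hx => ?_) (hs₀' ▸ hN n (not_lt.1 hn) G)
    rw [(hs x hx).1, (hs x hx).2]
    exact ⟨(if_neg fun h => hn h.1).symm, (if_neg fun h => hn h.1).symm⟩

end Output

/-! ### Labellings and their interval supergraphs -/

section Reach

variable {V : Type*} {G : SimpleGraph V} {W : Finset V} {l : V → ℕ} {u v : V} {m : ℕ}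

open Classical in
/-- The greatest label that `l` takes on the vertices of `W` in the closed neighbourhood of `v`. For
every labelling `l` the intervals `[l v, reach G W l v]` represent a supergraph of `G`. -/
noncomputable def reach (G : SimpleGraph V) (W : Finset V) (l : V → ℕ) (v : V) : ℕ :=
  W.sup fun a => if a = v ∨ G.Adj v a then l a else 0

lemma le_reach (hu : u ∈ W) (h : u = v ∨ G.Adj v u) : l u ≤ reach G W l v := by
  classical
  exact (if_pos h).ge.trans (Finset.le_sup (f := fun a => if a = v ∨ G.Adj v a then l a else 0) hu)

lemma reach_lt (hm : 0 < m) (h : ∀ a ∈ W, (a = v ∨ G.Adj v a) → l a < m) : reach G W l v < m := by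
  refine (Finset.sup_lt_iff hm).2 fun a ha => ?_
  split_ifs with hav
  exacts [h a ha hav, hm]

/-- The `d` labellings `l 0, …, l (d - 1)` separate `u` from its non-neighbours in `W`: for each of
them, the interval of `u` is strictly to the right in one of the representations given by
`reach`. -/
def Separates (G : SimpleGraph V) (W : Finset V) (d : ℕ) (l : ℕ → V → ℕ) (u : V) : Prop :=
  ∀ v ∈ W, u ≠ v → ¬ G.Adj u v → ∃ y < d, reach G W (l y) v < l y u

lemma adj_iff_forall_le_reach {d : ℕ} {l : ℕ → V → ℕ} (hl : ∀ u ∈ W, Separates G W d l u)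
    (hu : u ∈ W) (hv : v ∈ W) (huv : u ≠ v) :
    G.Adj u v ↔ ∀ y < d, l y u ≤ reach G W (l y) v ∧ l y v ≤ reach G W (l y) u := by
  refine ⟨fun h y _ => ⟨le_reach hu (.inr h.symm), le_reach hv (.inr h)⟩, fun h => ?_⟩
  by_contra hadj
  obtain ⟨y, hy, hlt⟩ := hl u hu v hv huv hadj
  exact hlt.not_ge (h y hy).1

open Classical in
/-- The left end point of the interval of `v` in a representation of a supergraph of `G` by
intervals of length `M`, where `M` bounds the labels. The intervals of the vertices in `S` have a
common point, and so have the others, while `u ∉ S` and `v ∈ S` have disjoint intervals if and only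
if `reach G W l v < l u`. -/
noncomputable def cubePos (G : SimpleGraph V) (W : Finset V) (S : Set V) (M : ℕ) (l : V → ℕ)
    (v : V) : ℕ :=
  if v ∈ S then reach G W l v else M + l v

variable {S : Set V} {M : ℕ}

lemma cubePos_le_add (hl : ∀ a, l a ≤ M) (hu : u ∈ W) (h : G.Adj u v) :
    cubePos G W S M l u ≤ cubePos G W S M l v + M := by
  have hreach : reach G W l u ≤ M := Finset.sup_le fun a _ => by
    split_ifs
    exacts [hl a, M.zero_le]
  have huv : l u ≤ reach G W l v := le_reach hu (.inr h.symm)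
  have := hl u
  unfold cubePos
  split_ifs <;> omega

lemma add_lt_cubePos (hu : u ∉ S) (hv : v ∈ S) (h : reach G W l v < l u) :
    cubePos G W S M l v + M < cubePos G W S M l u := by
  rw [cubePos, if_pos hv, cubePos, if_neg hu]
  omega

lemma adj_iff_forall_cubePos {d : ℕ} {l : ℕ → V → ℕ} {S : ℕ → Set V} (hl : ∀ y a, l y a ≤ M)
    (hsep : ∀ u ∈ W, ∀ v ∈ W, u ≠ v → ¬ G.Adj u v →
      ∃ y < d, u ∉ S y ∧ v ∈ S y ∧ reach G W (l y) v < l y u)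
    (hu : u ∈ W) (hv : v ∈ W) (huv : u ≠ v) :
    G.Adj u v ↔ ∀ y < d, cubePos G W (S y) M (l y) u ≤ cubePos G W (S y) M (l y) v + M ∧
      cubePos G W (S y) M (l y) v ≤ cubePos G W (S y) M (l y) u + M := by
  refine ⟨fun h y _ => ⟨cubePos_le_add (hl y) hu h, cubePos_le_add (hl y) hv h.symm⟩, fun h => ?_⟩
  by_contra hadj
  obtain ⟨y, hy, huS, hvS, hlt⟩ := hsep u hu v hv huv hadj
  exact (add_lt_cubePos huS hvS hlt).not_ge (h y hy).1

end Reach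

/-! ### Separating a block of vertices -/

section BlockRank

variable {V : Type*} {G : SimpleGraph V} {W B : Finset V} {u v : V}

open Classical in
/-- The rank of `v` in the block `B` ordered by `f`, and `0` outside `B`. -/
noncomputable def blockRank (B : Finset V) (f : V → ℝ) (v : V) : ℕ :=
  if v ∈ B then {a ∈ B | f a ≤ f v}.card else 0

lemma blockRank_le_card (f : V → ℝ) (v : V) : blockRank B f v ≤ B.card := by
  unfold blockRank
  split_ifs
  exacts [Finset.card_filter_le _ _, Nat.zero_le _]

lemma blockRank_lt_blockRank {f : V → ℝ} (hu : u ∈ B) (h : f v < f u) :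
    blockRank B f v < blockRank B f u := by
  classical
  have hmem : u ∈ B.filter fun a => f a ≤ f u := Finset.mem_filter.2 ⟨hu, le_rfl⟩
  unfold blockRank
  rw [if_pos hu]
  split_ifs with hv
  · refine Finset.card_lt_card (Finset.ssubset_iff_of_subset (fun a ha => ?_) |>.2
      ⟨u, hmem, fun hu' => h.not_ge (Finset.mem_filter.1 hu').2⟩)
    rw [Finset.mem_filter] at ha ⊢
    exact ⟨ha.1, ha.2.trans h.le⟩
  · exact Finset.card_pos.2 ⟨u, hmem⟩

lemma reach_blockRank_lt {f : V → ℝ} (hu : u ∈ B)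
    (h : ∀ a ∈ W, (a = v ∨ G.Adj v a) → f a < f u) :
    reach G W (blockRank B f) v < blockRank B f u := by
  classical
  refine reach_lt ?_ fun a ha hav => blockRank_lt_blockRank hu (h a ha hav)
  rw [blockRank, if_pos hu]
  exact Finset.card_pos.2 ⟨u, Finset.mem_filter.2 ⟨hu, le_rfl⟩⟩

lemma exists_separates_blockRank_of_boxes {b : ℕ} {l r : ℕ → V → ℝ}
    (hlr : ∀ j < b, ∀ v ∈ W, l j v ≤ r j v)
    (hrep : ∀ u ∈ W, ∀ v ∈ W, u ≠ v →
      (G.Adj u v ↔ ∀ j < b, l j u ≤ r j v ∧ l j v ≤ r j u)) :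
    ∃ f : ℕ → V → ℝ, ∀ (B : Finset V), ∀ u ∈ W, u ∈ B →
      Separates G W (2 * b) (fun y => blockRank B (f y)) u := by
  refine ⟨fun y v => if y < b then l y v else -r (y - b) v, fun B u huW hu v hv huv hadj => ?_⟩
  rw [hrep u huW v hv huv] at hadj
  push Not at hadj
  obtain ⟨j, hj, hadj⟩ := hadj
  have hle : ∀ a ∈ W, (a = v ∨ G.Adj v a) → l j a ≤ r j v ∧ l j v ≤ r j a := by
    rintro a ha (rfl | hva)
    · exact ⟨hlr j hj a ha, hlr j hj a ha⟩
    · exact ((hrep v hv a ha hva.ne).1 hva j hj).symm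
  by_cases hlt : r j v < l j u
  · refine ⟨j, by omega, reach_blockRank_lt hu fun a ha hav => ?_⟩
    simp only [if_pos hj]
    exact (hle a ha hav).1.trans_lt hlt
  · refine ⟨b + j, by omega, reach_blockRank_lt hu fun a ha hav => ?_⟩
    simp only [add_lt_iff_neg_left, not_lt_zero, if_false, Nat.add_sub_cancel_left]
    exact neg_lt_neg ((hadj (not_lt.1 hlt)).trans_le (hle a ha hav).2)

lemma separates_blockRank_single [DecidableEq V] {d y : ℕ} (g : ℕ → V) (hy : y < d)
    (hg : g y ∈ B) :
    Separates G W d (fun y => blockRank B (Pi.single (g y) 1)) (g y) := by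
  refine fun v _ hne hadj => ⟨y, hy, reach_blockRank_lt hg ?_⟩
  rintro a - hav
  have ha : a ≠ g y := by
    rintro rfl
    exact hav.elim hne fun h => hadj h.symm
  simp [Pi.single_eq_of_ne ha]

end BlockRank

/-! ### Codes of labellings -/

lemma exists_digits {b m : ℕ} {g : ℕ → ℕ} (hg : ∀ x < m, g x < b) :
    ∃ c < b ^ m, ∀ x < m, c / b ^ x % b = g x := by
  let g' : Fin m → Fin b := fun x => ⟨g x, hg x x.2⟩
  refine ⟨finFunctionFinEquiv g', (finFunctionFinEquiv g').2, fun x hx => ?_⟩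
  rw [← finFunctionFinEquiv_symm_apply_val (finFunctionFinEquiv g') ⟨x, hx⟩,
    Equiv.symm_apply_apply]

/-- The labelling number `j` of the block `{v | v / k = i}` that is encoded by `c`: the label of `v`
is the digit of `c` in base `k + 1` at place `j * k + v % k`. Labels outside the block are zero. -/
def codeLabel (k i c j v : ℕ) : ℕ :=
  if v / k = i then c / (k + 1) ^ (j * k + v % k) % (k + 1) else 0

lemma codeLabel_le (k i c j v : ℕ) : codeLabel k i c j v ≤ k := by
  unfold codeLabel
  split_ifs
  exacts [Nat.lt_succ_iff.1 (Nat.mod_lt _ k.succ_pos), k.zero_le]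

lemma div_eq_of_codeLabel_ne_zero {k i c j v : ℕ} (h : codeLabel k i c j v ≠ 0) : v / k = i := by
  by_contra hv
  exact h (if_neg hv)

lemma mem_Ico_block {k i v : ℕ} (hk : 0 < k) :
    v ∈ Finset.Ico (i * k) (i * k + k) ↔ v / k = i := by
  rw [Finset.mem_Ico, Nat.div_eq_iff hk]
  omega

lemma exists_codeLabel_eq_blockRank {k e : ℕ} (hk : 0 < k) (he : e ≤ k) (i : ℕ)
    (f : ℕ → ℕ → ℝ) :
    ∃ c < (k + 1) ^ (k * k), ∀ j < e,
      codeLabel k i c j = blockRank (Finset.Ico (i * k) (i * k + k)) (f j) := by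
  set B := Finset.Ico (i * k) (i * k + k)
  obtain ⟨c, hc, hdigit⟩ := exists_digits (b := k + 1) (m := k * k)
    (g := fun x => blockRank B (f (x / k)) (i * k + x % k)) fun x _ =>
      Nat.lt_succ_iff.2 ((blockRank_le_card _ _).trans_eq (by simp [B]))
  refine ⟨c, hc, fun j hj => funext fun v => ?_⟩
  unfold codeLabel
  split_ifs with hv
  · have hlt : j * k + v % k < k * k :=
      Nat.lt_mul_of_div_lt ((mul_add_div_of_lt (Nat.mod_lt v hk)).trans_lt (hj.trans_le he)) hk
    have hv' : i * k + v % k = v := by rw [← hv, Nat.div_add_mod']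
    rw [hdigit _ hlt, mul_add_div_of_lt (Nat.mod_lt v hk), Nat.mul_add_mod_of_lt (Nat.mod_lt v hk),
      hv']
  · exact (if_neg fun h => hv ((mem_Ico_block hk).1 h)).symm

/-- The size of the blocks: the greatest `k ≤ n` for which `k` labellings of a block have at most
`(n + 1) ^ 20` codes. -/
def blockSize (n : ℕ) : ℕ := Nat.findGreatest (fun k => (k + 1) ^ (k * k) ≤ (n + 1) ^ 20) n

lemma blockSize_pow_le (n : ℕ) : (blockSize n + 1) ^ (blockSize n * blockSize n) ≤ (n + 1) ^ 20 :=
  Nat.findGreatest_spec (P := fun k => (k + 1) ^ (k * k) ≤ (n + 1) ^ 20) n.zero_le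
    ((pow_zero 1).trans_le (Nat.one_le_pow _ _ n.succ_pos))

lemma blockSize_pos {n : ℕ} (hn : 0 < n) : 0 < blockSize n :=
  Nat.le_findGreatest hn (by
    simpa using (show 1 + 1 ≤ n + 1 by omega).trans (Nat.le_self_pow (by norm_num) (n + 1)))

/-- The number `c` encodes `e` labellings of the `i`-th block that separate each of its vertices
from its non-neighbours. -/
def IsBlockCode (D : FinGraph) (e i c : ℕ) : Prop :=
  ∀ u < D.1, u / blockSize D.1 = i →
    Separates D.natGraph (Finset.range D.1) e (codeLabel (blockSize D.1) i c) u

/-- The least number of labellings per block for which every block has a small code. -/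
noncomputable def familyCount (D : FinGraph) : ℕ :=
  sInf {e | ∀ i < D.1, ∃ c < (D.1 + 1) ^ 20, IsBlockCode D e i c}

/-- The first code of separating labellings of the `i`-th block. -/
noncomputable def blockCode (D : FinGraph) (i : ℕ) : ℕ :=
  sInf {c | IsBlockCode D (familyCount D) i c}

section BlockCode

variable {D : FinGraph} {e i : ℕ}

lemma Separates.congr {V : Type*} {G : SimpleGraph V} {W : Finset V} {d : ℕ} {l l' : ℕ → V → ℕ}
    {u : V} (h : Separates G W d l u) (hl : ∀ y < d, l y = l' y) : Separates G W d l' u :=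
  fun v hv huv hadj =>
    let ⟨y, hy, hlt⟩ := h v hv huv hadj
    ⟨y, hy, hl y hy ▸ hlt⟩

lemma exists_isBlockCode (hD : 0 < D.1) (he : e ≤ blockSize D.1) {f : ℕ → ℕ → ℝ}
    (h : ∀ u < D.1, u / blockSize D.1 = i → Separates D.natGraph (Finset.range D.1) e
      (fun y => blockRank (Finset.Ico (i * blockSize D.1) (i * blockSize D.1 + blockSize D.1))
        (f y)) u) :
    ∃ c < (D.1 + 1) ^ 20, IsBlockCode D e i c := by
  obtain ⟨c, hc, hlabel⟩ := exists_codeLabel_eq_blockRank (blockSize_pos hD) he i f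
  exact ⟨c, hc.trans_le (blockSize_pow_le _), fun u hu hui =>
    (h u hu hui).congr fun y hy => (hlabel y hy).symm⟩

lemma exists_isBlockCode_blockSize (hD : 0 < D.1) (i : ℕ) :
    ∃ c < (D.1 + 1) ^ 20, IsBlockCode D (blockSize D.1) i c := by
  set k := blockSize D.1
  have hk : 0 < k := blockSize_pos hD
  refine exists_isBlockCode (f := fun y => Pi.single (i * k + y) 1) hD le_rfl fun u _ hui => ?_
  have hu' : i * k + u % k = u := by rw [← hui, Nat.div_add_mod']
  have := separates_blockRank_single (G := D.natGraph) (W := Finset.range D.1)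
    (B := Finset.Ico (i * k) (i * k + k)) (fun y => i * k + y) (Nat.mod_lt u hk)
    ((mem_Ico_block hk).2 (hu'.symm ▸ hui))
  rwa [hu'] at this

lemma familyCount_spec (D : FinGraph) :
    ∀ i < D.1, ∃ c < (D.1 + 1) ^ 20, IsBlockCode D (familyCount D) i c :=
  Nat.sInf_mem (s := {e | ∀ i < D.1, ∃ c < (D.1 + 1) ^ 20, IsBlockCode D e i c})
    ⟨blockSize D.1, fun i hi => exists_isBlockCode_blockSize (by omega) i⟩

lemma exists_isBlockCode_familyCount (D : FinGraph) (i : ℕ) :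
    ∃ c < (D.1 + 1) ^ 20, IsBlockCode D (familyCount D) i c := by
  by_cases hi : i < D.1
  · exact familyCount_spec D i hi
  · exact ⟨0, by positivity, fun u hu hui =>
      absurd (hui.symm.trans_le (Nat.div_le_self _ _)) (by omega)⟩

lemma isBlockCode_blockCode (D : FinGraph) (i : ℕ) :
    IsBlockCode D (familyCount D) i (blockCode D i) :=
  Nat.sInf_mem (s := {c | IsBlockCode D (familyCount D) i c})
    ((exists_isBlockCode_familyCount D i).imp fun _ hc => hc.2)

lemma familyCount_le (h : ∀ i < D.1, ∃ c < (D.1 + 1) ^ 20, IsBlockCode D e i c) :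
    familyCount D ≤ e :=
  Nat.sInf_le h

lemma familyCount_le_blockSize (D : FinGraph) : familyCount D ≤ blockSize D.1 :=
  familyCount_le fun i hi => exists_isBlockCode_blockSize (by omega) i

lemma familyCount_le_of_boxes {b : ℕ} {l r : ℕ → ℕ → ℝ}
    (hlr : ∀ j < b, ∀ v ∈ Finset.range D.1, l j v ≤ r j v)
    (hrep : ∀ u ∈ Finset.range D.1, ∀ v ∈ Finset.range D.1, u ≠ v →
      (D.natGraph.Adj u v ↔ ∀ j < b, l j u ≤ r j v ∧ l j v ≤ r j u)) :
    familyCount D ≤ 2 * b := by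
  rcases le_total (2 * b) (blockSize D.1) with hb | hb
  · obtain ⟨f, hf⟩ := exists_separates_blockRank_of_boxes hlr hrep
    refine familyCount_le fun i hi => exists_isBlockCode (f := f) (by omega) hb fun u hu hui => ?_
    exact hf _ u (Finset.mem_range.2 hu) ((mem_Ico_block (blockSize_pos (by omega))).2 hui)
  · exact (familyCount_le_blockSize D).trans hb

/-- The labellings of all blocks, those of the first block first. -/
noncomputable def rowLabel (D : FinGraph) (y v : ℕ) : ℕ :=
  codeLabel (blockSize D.1) (y / familyCount D) (blockCode D (y / familyCount D))
    (y % familyCount D) v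

/-- The number of blocks. -/
def numBlocks (n : ℕ) : ℕ := n ⌈/⌉ blockSize n

lemma div_blockSize_lt_numBlocks {n u : ℕ} (hu : u < n) : u / blockSize n < numBlocks n := by
  have hk : 0 < blockSize n := blockSize_pos (by omega)
  rw [Nat.div_lt_iff_lt_mul hk]
  by_contra! h
  have := (ceilDiv_le_iff_le_mul (b := n) (c := numBlocks n) hk).1 le_rfl
  rw [mul_comm] at this
  omega

lemma separates_rowLabel {u : ℕ} (hu : u < D.1) :
    Separates D.natGraph (Finset.range D.1) (numBlocks D.1 * familyCount D) (rowLabel D) u := by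
  intro v hv huv hadj
  obtain ⟨j, hj, hlt⟩ := isBlockCode_blockCode D (u / blockSize D.1) u hu rfl v hv huv hadj
  have hdiv := mul_add_div_of_lt (m := u / blockSize D.1) hj
  refine ⟨u / blockSize D.1 * familyCount D + j,
    Nat.lt_mul_of_div_lt (hdiv.trans_lt (div_blockSize_lt_numBlocks hu)) (by omega), ?_⟩
  unfold rowLabel
  rwa [hdiv, Nat.mul_add_mod_of_lt hj]

end BlockCode

section PolyTimeCodes

variable {α : Type} [Context α] {k e i c j y v : α → ℕ}

lemma PolyTime.codeLabel (hk : PolyTime k) (hi : PolyTime i) (hc : PolyTime c) (hj : PolyTime j)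
    (hv : PolyTime v) : PolyTime fun a => codeLabel (k a) (i a) (c a) (j a) (v a) :=
  .ite ((hv.div hk).eq hi)
    ((hc.div_pow (hk.add (.const 1)) ((hj.mul hk).add (hv.mod hk))).mod (hk.add (.const 1)))
    (.const 0)

lemma PolyTime.reach {l : α → ℕ → ℕ} (hl : PolyTime fun x : α × ℕ => l x.1 x.2)
    (hv : PolyTime v) :
    PolyTime fun a => reach (base a).natGraph (Finset.range (base a).1) (l a) (v a) := by
  classical
  exact .sup polyTime_order
    ((PolyTime.ite ((PolyTime.snd.eq hv.fst).or (.adj hv.fst .snd)) hl (.const 0)).congr fun x => by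
      congr)

lemma PolyTime.blockSize (hv : PolyTime v) : PolyTime fun a => blockSize (v a) :=
  .findGreatest hv (.pow_le (PolyTime.snd.add (.const 1)) (PolyTime.snd.mul .snd)
    (hv.fst.add (.const 1)|>.pow_const 20))

lemma PolyTime.numBlocks (hv : PolyTime v) : PolyTime fun a => numBlocks (v a) :=
  (((hv.add hv.blockSize).sub (.const 1)).div hv.blockSize).congr fun _ =>
    (Nat.ceilDiv_eq_add_pred_div _ _).symm

lemma PolyTimePred.isBlockCode (he : PolyTime e) (hi : PolyTime i) (hc : PolyTime c) :
    PolyTimePred fun a => IsBlockCode (base a) (e a) (i a) (c a) := by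
  have hk : PolyTime fun a : α => Boxicity.blockSize (base a).1 := polyTime_order.blockSize
  let l (a : α) : ℕ → ℕ → ℕ := Boxicity.codeLabel (Boxicity.blockSize (base a).1) (i a) (c a)
  let S (a : α) (u v : ℕ) : Prop := ∃ y < e a,
    Boxicity.reach (base a).natGraph (Finset.range (base a).1) (l a y) v < l a y u
  have hlabel : PolyTime fun x : (((α × ℕ) × ℕ) × ℕ) × ℕ => l x.1.1.1.1 x.1.2 x.2 :=
    .codeLabel hk.fst.fst.fst.fst hi.fst.fst.fst.fst hc.fst.fst.fst.fst PolyTime.snd.fst .snd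
  have hlabel' : PolyTime fun x : ((α × ℕ) × ℕ) × ℕ => l x.1.1.1 x.2 x.1.1.2 :=
    .codeLabel hk.fst.fst.fst hi.fst.fst.fst hc.fst.fst.fst .snd PolyTime.snd.fst.fst
  have hreach := PolyTime.reach (l := fun x : ((α × ℕ) × ℕ) × ℕ => l x.1.1.1 x.2) hlabel
    PolyTime.snd.fst
  have hS : PolyTimePred fun x : (α × ℕ) × ℕ => S x.1.1 x.1.2 x.2 :=
    .exists_lt he.fst.fst (hreach.lt hlabel')
  refine (PolyTimePred.forall_lt (P := fun a u => u / Boxicity.blockSize (base a).1 = i a →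
    ∀ v < (base a).1, u ≠ v → ¬ (base a).natGraph.Adj u v → S a u v) polyTime_order
    (.imp ((PolyTime.snd.div hk.fst).eq hi.fst) ?_)).congr fun a => ?_
  · exact .forall_lt (P := fun (x : α × ℕ) v => x.2 ≠ v → ¬ (base x.1).natGraph.Adj x.2 v →
      S x.1 x.2 v) polyTime_order (.imp (PolyTime.snd.fst.eq .snd).not
        (.imp (PolyTimePred.adj PolyTime.snd.fst .snd).not hS))
  · simp only [IsBlockCode, Separates, Finset.mem_range, S, l]
    rfl

lemma polyTime_codeBound : PolyTime fun a : α => ((base a).1 + 1) ^ 20 :=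
  (polyTime_order.add (.const 1)).pow_const 20

lemma polyTime_familyCount : PolyTime fun a : α => familyCount (base a) :=
  .sInf polyTime_order.blockSize (.forall_lt polyTime_order
    (.exists_lt polyTime_codeBound (.isBlockCode PolyTime.snd.fst.fst PolyTime.snd.fst .snd)))
    fun _ => ⟨_, le_rfl, fun i hi =>
      exists_isBlockCode_blockSize ((Nat.zero_le i).trans_lt hi) i⟩

lemma PolyTime.blockCode (hi : PolyTime i) : PolyTime fun a => blockCode (base a) (i a) :=
  .sInf polyTime_codeBound (.isBlockCode polyTime_familyCount.fst hi.fst .snd) fun a =>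
    (exists_isBlockCode_familyCount (base a) (i a)).imp fun _ h => ⟨h.1.le, h.2⟩

lemma PolyTime.rowLabel (hy : PolyTime y) (hv : PolyTime v) :
    PolyTime fun a => rowLabel (base a) (y a) (v a) :=
  .codeLabel polyTime_order.blockSize (hy.div polyTime_familyCount)
    (.blockCode (hy.div polyTime_familyCount)) (hy.mod polyTime_familyCount) hv

end PolyTimeCodes

/-! ### Box and cube representations in tables -/

section IntervalGraph

variable {V : Type*}

lemma intervalGraph_adj {l r : V → ℝ} (h : ∀ v, l v ≤ r v) (u v : V) :
    (intervalGraph l r).Adj u v ↔ u ≠ v ∧ l u ≤ r v ∧ l v ≤ r u := by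
  change u ≠ v ∧ _ ↔ _
  rw [Set.Icc_inter_Icc, Set.nonempty_Icc, sup_le_iff, le_inf_iff, le_inf_iff]
  have := h u
  have := h v
  tauto

lemma eq_iInf_intervalGraph_iff (G : SimpleGraph V) {d : ℕ} {l r : Fin d → V → ℝ}
    (h : ∀ i v, l i v ≤ r i v) : G = ⨅ i, intervalGraph (l i) (r i) ↔
      ∀ u v, u ≠ v → (G.Adj u v ↔ ∀ i, l i u ≤ r i v ∧ l i v ≤ r i u) := by
  simp only [SimpleGraph.ext_iff, funext_iff]
  refine forall₂_congr fun u v => ?_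
  simp only [SimpleGraph.iInf_adj, intervalGraph_adj (h _), eq_iff_iff]
  by_cases huv : u = v <;> simp [huv]

lemma IsCubeRepresentation.isBoxRepresentation {G : SimpleGraph V} {k : ℕ}
    {I : Fin k → SimpleGraph V} (h : IsCubeRepresentation G I) : IsBoxRepresentation G I := by
  refine ⟨fun i => ?_, h.2⟩
  obtain ⟨l, hl⟩ := h.1 i
  exact ⟨l, _, fun v => by linarith, hl⟩

end IntervalGraph

/-- The table with `n` columns that has the entry `l i v` in row `i` and column `v`, listed row by
row. -/
def tabulate (n : ℕ) (l : ℕ → ℕ → ℕ) (x : ℕ) : ℕ := l (x / n) (x % n)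

lemma tabulate_mul_add {n v : ℕ} (l : ℕ → ℕ → ℕ) (i : ℕ) (hv : v < n) :
    tabulate n l (i * n + v) = l i v := by
  rw [tabulate, mul_add_div_of_lt hv, Nat.mul_add_mod_of_lt hv]

/-- The tables `X` and `Y` list the left and right end points of a box representation of dimension
`d`, in the layout of `HoldsBoxRepresentation`. -/
def IsBoxTable {n : ℕ} (G : SimpleGraph (Fin n)) (d : ℕ) (X Y : ℕ → ℕ) : Prop :=
  (∀ (i : Fin d) (v : Fin n), X (i * n + v) ≤ Y (i * n + v)) ∧
  IsBoxRepresentation G fun i : Fin d =>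
    intervalGraph (fun v : Fin n => (X (i * n + v) : ℝ)) (fun v : Fin n => (Y (i * n + v) : ℝ))

/-- The tables `X` and `Y` list the numerators and denominators of a cube representation of
dimension `d`, in the layout of `HoldsCubeRepresentation`. -/
def IsCubeTable {n : ℕ} (G : SimpleGraph (Fin n)) (d : ℕ) (X Y : ℕ → ℕ) : Prop :=
  (∀ i : Fin d, 0 < Y i) ∧
  IsCubeRepresentation G fun i : Fin d =>
    intervalGraph (fun v : Fin n => (X (i * n + v) : ℝ) / (Y i : ℝ))
      (fun v : Fin n => (X (i * n + v) : ℝ) / (Y i : ℝ) + 1)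

section Tables

variable {D : FinGraph} {d : ℕ}

lemma mul_add_lt_mul_add_one {n : ℕ} (i : Fin d) (v : Fin n) : i * n + v < d * (n + 1) := by
  have := Nat.mul_le_mul_right n (Nat.succ_le_of_lt i.2)
  rw [Nat.succ_mul] at this
  rw [mul_add]
  omega

lemma IsBoxTable.congr {n : ℕ} {G : SimpleGraph (Fin n)} {X X' Y Y' : ℕ → ℕ}
    (h : IsBoxTable G d X Y) (hXY : ∀ x < d * (n + 1), X x = X' x ∧ Y x = Y' x) :
    IsBoxTable G d X' Y' := by
  have hX (i : Fin d) (v : Fin n) := (hXY _ (mul_add_lt_mul_add_one i v)).1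
  have hY (i : Fin d) (v : Fin n) := (hXY _ (mul_add_lt_mul_add_one i v)).2
  simpa only [IsBoxTable, hX, hY] using h

lemma IsCubeTable.congr {n : ℕ} {G : SimpleGraph (Fin n)} {X X' Y Y' : ℕ → ℕ}
    (h : IsCubeTable G d X Y) (hXY : ∀ x < d * (n + 1), X x = X' x ∧ Y x = Y' x) :
    IsCubeTable G d X' Y' := by
  have hX (i : Fin d) (v : Fin n) := (hXY _ (mul_add_lt_mul_add_one i v)).1
  have hY (i : Fin d) := (hXY i (i.2.trans_le (Nat.le_mul_of_pos_right _ n.succ_pos))).2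
  simpa only [IsCubeTable, hX, hY] using h

lemma isBoxTable_tabulate {l r : ℕ → ℕ → ℕ} (hlr : ∀ i < d, ∀ v < D.1, l i v ≤ r i v)
    (h : ∀ u < D.1, ∀ v < D.1, u ≠ v →
      (D.natGraph.Adj u v ↔ ∀ i < d, l i u ≤ r i v ∧ l i v ≤ r i u)) :
    IsBoxTable D.2 d (tabulate D.1 l) (tabulate D.1 r) := by
  unfold IsBoxTable
  simp only [fun (i : Fin d) (v : Fin D.1) => tabulate_mul_add l i v.2,
    fun (i : Fin d) (v : Fin D.1) => tabulate_mul_add r i v.2]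
  have hlr' (i : Fin d) (v : Fin D.1) : (l i v : ℝ) ≤ r i v := by exact_mod_cast hlr i i.2 v v.2
  refine ⟨fun i v => hlr i i.2 v v.2, fun i => ⟨_, _, hlr' i, rfl⟩,
    (eq_iInf_intervalGraph_iff _ hlr').2 fun u v huv => ?_⟩
  rw [← SimpleGraph.map_adj_apply (f := Fin.valEmbedding)]
  refine (h u u.2 v v.2 (Fin.val_injective.ne huv)).trans ?_
  simp only [Nat.cast_le, Fin.forall_iff]

lemma isCubeTable_tabulate {l : ℕ → ℕ → ℕ} {M : ℕ} (hM : 0 < M)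
    (h : ∀ u < D.1, ∀ v < D.1, u ≠ v →
      (D.natGraph.Adj u v ↔ ∀ i < d, l i u ≤ l i v + M ∧ l i v ≤ l i u + M)) :
    IsCubeTable D.2 d (tabulate D.1 l) fun _ => M := by
  unfold IsCubeTable
  simp only [fun (i : Fin d) (v : Fin D.1) => tabulate_mul_add l i v.2]
  refine ⟨fun _ => hM, fun i => ⟨_, rfl⟩,
    (eq_iInf_intervalGraph_iff _ fun i v => by linarith).2 fun u v huv => ?_⟩
  have hle (a b : ℕ) : (a : ℝ) / M ≤ b / M + 1 ↔ a ≤ b + M := by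
    have hM' : (0 : ℝ) < M := by exact_mod_cast hM
    rw [div_add_one hM'.ne', div_le_div_iff_of_pos_right hM']
    norm_cast
  rw [← SimpleGraph.map_adj_apply (f := Fin.valEmbedding)]
  refine (h u u.2 v v.2 (Fin.val_injective.ne huv)).trans ?_
  simp only [hle, Fin.forall_iff]

lemma isBoxTable_of_separates {l : ℕ → ℕ → ℕ}
    (hl : ∀ u ∈ Finset.range D.1, Separates D.natGraph (Finset.range D.1) d l u) :
    IsBoxTable D.2 d (tabulate D.1 l)
      (tabulate D.1 fun i => reach D.natGraph (Finset.range D.1) (l i)) :=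
  isBoxTable_tabulate (fun _ _ _ hv => le_reach (Finset.mem_range.2 hv) (.inl rfl))
    fun _ hu _ hv => adj_iff_forall_le_reach hl (Finset.mem_range.2 hu) (Finset.mem_range.2 hv)

lemma isBoxTable_rowLabel (D : FinGraph) :
    IsBoxTable D.2 (numBlocks D.1 * familyCount D) (tabulate D.1 (rowLabel D))
      (tabulate D.1 fun i => reach D.natGraph (Finset.range D.1) (rowLabel D i)) :=
  isBoxTable_of_separates fun _ hu => separates_rowLabel (Finset.mem_range.1 hu)

end Tables

/-! ### The cube representation -/

/-- The number of binary digits of the numbers up to `blockSize n`. -/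
def numBits (n : ℕ) : ℕ := Nat.log 2 (blockSize n) + 1

/-- The position of `v` in the `i`-th block of size `k`, and `k` if `v` is not in this block. -/
def blockPos (k i v : ℕ) : ℕ := if v / k = i then v % k else k

/-- The unit intervals of the cube representation, before dividing by `blockSize n + 1`. There are
two rows for each row `z / 2 / q` of `rowLabel` and each binary digit `z / 2 % q`, where `q` is
`numBits n`: the vertices are split according to this digit of their position in the block. -/
noncomputable def cubeRow (D : FinGraph) (z : ℕ) : ℕ → ℕ :=
  cubePos D.natGraph (Finset.range D.1)
    {v | blockPos (blockSize D.1) (z / 2 / numBits D.1 / familyCount D) v /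
      2 ^ (z / 2 % numBits D.1) % 2 = z % 2}
    (blockSize D.1 + 1) (rowLabel D (z / 2 / numBits D.1))

/-- The dimension of the cube representation. -/
noncomputable def cubeDim (D : FinGraph) : ℕ :=
  numBlocks D.1 * familyCount D * numBits D.1 * 2

lemma exists_div_pow_mod_two_ne {a b q : ℕ} (ha : a < 2 ^ q) (hb : b < 2 ^ q) (hab : a ≠ b) :
    ∃ h < q, a / 2 ^ h % 2 ≠ b / 2 ^ h % 2 := by
  obtain ⟨h, hne⟩ := Nat.exists_testBit_ne_of_ne hab
  refine ⟨h, ?_, fun heq => hne ?_⟩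
  · by_contra! hq
    have hpow := Nat.pow_le_pow_right two_pos hq
    exact hne ((Nat.testBit_lt_two_pow (ha.trans_le hpow)).trans
      (Nat.testBit_lt_two_pow (hb.trans_le hpow)).symm)
  · rw [Nat.testBit_eq_decide_div_mod_eq, Nat.testBit_eq_decide_div_mod_eq, heq]

lemma blockPos_ne {k i u v : ℕ} (hk : 0 < k) (hu : u / k = i) (huv : u ≠ v) :
    blockPos k i u ≠ blockPos k i v := by
  rw [blockPos, if_pos hu, blockPos]
  split_ifs with hv
  · exact fun h => huv (by rw [← Nat.div_add_mod u k, ← Nat.div_add_mod v k, hu, hv, h])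
  · exact (Nat.mod_lt u hk).ne

lemma blockPos_lt_two_pow {n : ℕ} (hn : 0 < n) (i v : ℕ) :
    blockPos (blockSize n) i v < 2 ^ numBits n := by
  refine lt_of_le_of_lt ?_ (Nat.lt_pow_succ_log_self one_lt_two (blockSize n))
  unfold blockPos
  split_ifs
  exacts [(Nat.mod_lt v (blockSize_pos hn)).le, le_rfl]

section CubeRow

variable {D : FinGraph}

lemma exists_side_of_reach_lt {u v y : ℕ} (hu : u < D.1) (huv : u ≠ v)
    (hy : y < numBlocks D.1 * familyCount D)
    (hlt : reach D.natGraph (Finset.range D.1) (rowLabel D y) v < rowLabel D y u) :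
    ∃ z < cubeDim D, z / 2 / numBits D.1 = y ∧
      blockPos (blockSize D.1) (y / familyCount D) u / 2 ^ (z / 2 % numBits D.1) % 2 ≠ z % 2 ∧
      blockPos (blockSize D.1) (y / familyCount D) v / 2 ^ (z / 2 % numBits D.1) % 2 = z % 2 := by
  set i := y / familyCount D
  have hn : 0 < D.1 := (Nat.zero_le u).trans_lt hu
  have hui : u / blockSize D.1 = i := div_eq_of_codeLabel_ne_zero ((Nat.zero_le _).trans_lt hlt).ne'
  obtain ⟨h, hh, hbit⟩ := exists_div_pow_mod_two_ne (blockPos_lt_two_pow hn i u)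
    (blockPos_lt_two_pow hn i v) (blockPos_ne (blockSize_pos hn) hui huv)
  have ho : blockPos (blockSize D.1) i v / 2 ^ h % 2 < 2 := Nat.mod_lt _ two_pos
  set o := blockPos (blockSize D.1) i v / 2 ^ h % 2
  refine ⟨(y * numBits D.1 + h) * 2 + o, ?_, ?_⟩
  · refine Nat.lt_mul_of_div_lt ?_ two_pos
    rw [mul_add_div_of_lt ho]
    refine Nat.lt_mul_of_div_lt ?_ (Nat.succ_pos _)
    rwa [mul_add_div_of_lt hh]
  · rw [mul_add_div_of_lt ho, mul_add_div_of_lt hh, Nat.mul_add_mod_of_lt hh,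
      Nat.mul_add_mod_of_lt ho]
    exact ⟨rfl, hbit, rfl⟩

lemma isCubeTable_cubeRow (D : FinGraph) :
    IsCubeTable D.2 (cubeDim D) (tabulate D.1 (cubeRow D)) fun _ => blockSize D.1 + 1 := by
  refine isCubeTable_tabulate (Nat.succ_pos _) fun u hu v hv =>
    adj_iff_forall_cubePos (l := fun z => rowLabel D (z / 2 / numBits D.1))
      (fun z a => (codeLabel_le _ _ _ _ _).trans (Nat.le_succ _)) ?_
      (Finset.mem_range.2 hu) (Finset.mem_range.2 hv)
  intro u hu v hv huv hadj
  rw [Finset.mem_range] at hu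
  obtain ⟨y, hy, hlt⟩ := separates_rowLabel hu v hv huv hadj
  obtain ⟨z, hz, rfl, huz, hvz⟩ := exists_side_of_reach_lt hu huv hy hlt
  exact ⟨z, hz, huz, hvz, hlt⟩

end CubeRow

/-! ### Optimal representations -/

section Optimal

lemma exists_extension {d n : ℕ} (f : Fin d → Fin n → ℝ) :
    ∃ g : ℕ → ℕ → ℝ, ∀ i : Fin d, (fun v : Fin n => g i v) = f i :=
  ⟨fun i v => if h : i < d ∧ v < n then f ⟨i, h.1⟩ ⟨v, h.2⟩ else 0, fun i => by simp⟩

variable (D : FinGraph)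

lemma exists_isCubeRepresentation_cub :
    ∃ I : Fin (cub D.2) → SimpleGraph (Fin D.1), IsCubeRepresentation D.2 I :=
  Nat.sInf_mem (s := {k | ∃ I : Fin k → SimpleGraph (Fin D.1), IsCubeRepresentation D.2 I})
    ⟨cubeDim D, _, (isCubeTable_cubeRow D).2⟩

lemma box_le_cub : box D.2 ≤ cub D.2 :=
  Nat.sInf_le ((exists_isCubeRepresentation_cub D).imp fun _ h => h.isBoxRepresentation)

lemma exists_isBoxRepresentation_box :
    ∃ I : Fin (box D.2) → SimpleGraph (Fin D.1), IsBoxRepresentation D.2 I :=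
  Nat.sInf_mem (s := {k | ∃ I : Fin k → SimpleGraph (Fin D.1), IsBoxRepresentation D.2 I})
    ⟨cubeDim D, _, (isCubeTable_cubeRow D).2.isBoxRepresentation⟩

lemma forall_range_adj_iff_of_eq_iInf {d : ℕ} {l r : ℕ → ℕ → ℝ}
    (hlr : ∀ (i : Fin d) (v : Fin D.1), l i v ≤ r i v)
    (h : D.2 = ⨅ i : Fin d, intervalGraph (fun v : Fin D.1 => l i v) fun v => r i v) :
    ∀ u ∈ Finset.range D.1, ∀ v ∈ Finset.range D.1, u ≠ v →
      (D.natGraph.Adj u v ↔ ∀ i < d, l i u ≤ r i v ∧ l i v ≤ r i u) := by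
  intro u hu v hv huv
  rw [Finset.mem_range] at hu hv
  have := (eq_iInf_intervalGraph_iff _ hlr).1 h ⟨u, hu⟩ ⟨v, hv⟩ (by simpa using huv)
  rw [← SimpleGraph.map_adj_apply (f := Fin.valEmbedding), Fin.forall_iff] at this
  exact this

lemma exists_boxes : ∃ l r : ℕ → ℕ → ℝ,
    (∀ i < box D.2, ∀ v ∈ Finset.range D.1, l i v ≤ r i v) ∧
    ∀ u ∈ Finset.range D.1, ∀ v ∈ Finset.range D.1, u ≠ v →
      (D.natGraph.Adj u v ↔ ∀ i < box D.2, l i u ≤ r i v ∧ l i v ≤ r i u) := by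
  obtain ⟨I, hI, hD⟩ := exists_isBoxRepresentation_box D
  choose l₀ r₀ hlr hI using hI
  obtain ⟨l, hl⟩ := exists_extension l₀
  obtain ⟨r, hr⟩ := exists_extension r₀
  simp only [← hl, ← hr] at hlr hI
  rw [iInf_congr hI] at hD
  exact ⟨l, r, fun i hi v hv => hlr ⟨i, hi⟩ ⟨v, Finset.mem_range.1 hv⟩,
    forall_range_adj_iff_of_eq_iInf D hlr hD⟩

lemma exists_cubes : ∃ l : ℕ → ℕ → ℝ,
    ∀ u ∈ Finset.range D.1, ∀ v ∈ Finset.range D.1, u ≠ v →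
      (D.natGraph.Adj u v ↔ ∀ i < cub D.2, l i u ≤ l i v + 1 ∧ l i v ≤ l i u + 1) := by
  obtain ⟨I, hI, hD⟩ := exists_isCubeRepresentation_cub D
  choose l₀ hI using hI
  obtain ⟨l, hl⟩ := exists_extension l₀
  simp only [← hl] at hI
  rw [iInf_congr hI] at hD
  exact ⟨l, forall_range_adj_iff_of_eq_iInf D (r := fun i v => l i v + 1)
    (fun i v => by linarith) hD⟩

lemma familyCount_le_two_mul_box : familyCount D ≤ 2 * box D.2 := by
  obtain ⟨l, r, hlr, h⟩ := exists_boxes D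
  exact familyCount_le_of_boxes hlr h

lemma exists_isBoxTable_two_mul_box : ∃ X Y, IsBoxTable D.2 (2 * box D.2) X Y := by
  obtain ⟨l, r, hlr, h⟩ := exists_boxes D
  obtain ⟨f, hf⟩ := exists_separates_blockRank_of_boxes hlr h
  exact ⟨_, _, isBoxTable_of_separates fun u hu => hf _ u hu hu⟩

end Optimal

lemma exists_nat_scale {ι : Type*} (S : Finset ι) (f : ι → ℝ) :
    ∃ M > 0, ∃ g : ι → ℕ, ∀ a ∈ S, ∀ b ∈ S, g a ≤ g b + M ↔ f a ≤ f b + 1 := by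
  obtain ⟨c, hc⟩ := (S.finite_toSet.image f).bddBelow
  have hc : ∀ a ∈ S, c ≤ f a := fun a ha => hc ⟨a, ha, rfl⟩
  have hgap : ∀ᶠ M : ℕ in Filter.atTop, ∀ a ∈ S, ∀ b ∈ S, f b + 1 < f a →
      1 ≤ M * (f a - f b - 1) := by
    refine (Filter.eventually_all_finset S).2 fun a _ => (Filter.eventually_all_finset S).2
      fun b _ => Filter.eventually_imp_distrib_left.2 fun h => ?_
    exact ((tendsto_natCast_atTop_atTop (R := ℝ)).atTop_mul_const
      (show 0 < f a - f b - 1 by linarith)).eventually_ge_atTop 1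
  obtain ⟨M, hM, hM0⟩ := (hgap.and (Filter.eventually_gt_atTop 0)).exists
  refine ⟨M, hM0, fun a => ⌊M * (f a - c)⌋₊, fun a ha b hb => ?_⟩
  have hnonneg : ∀ a ∈ S, 0 ≤ M * (f a - c) := fun a ha =>
    mul_nonneg M.cast_nonneg (sub_nonneg.2 (hc a ha))
  rw [← Nat.floor_add_natCast (hnonneg b hb)]
  refine ⟨fun h => ?_, fun h => Nat.floor_le_floor ?_⟩
  · by_contra! hlt
    have hle : M * (f b - c) + M + 1 ≤ M * (f a - c) := by linarith [hM a ha b hb hlt]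
    have hfloor := Nat.floor_le_floor hle
    rw [Nat.floor_add_one (by linarith [hnonneg b hb, M.cast_nonneg (α := ℝ)])] at hfloor
    exact (Nat.lt_of_succ_le hfloor).not_ge h
  · linarith [mul_le_mul_of_nonneg_left h (M.cast_nonneg (α := ℝ))]

lemma exists_isCubeTable_cub (D : FinGraph) : ∃ X Y, IsCubeTable D.2 (cub D.2) X Y := by
  obtain ⟨l, hl⟩ := exists_cubes D
  obtain ⟨M, hM, g, hg⟩ := exists_nat_scale (Finset.range (cub D.2) ×ˢ Finset.range D.1)
    fun x => l x.1 x.2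
  refine ⟨_, _, isCubeTable_tabulate (l := fun i v => g (i, v)) hM fun u hu v hv huv => ?_⟩
  have hmem {i w : ℕ} (hi : i < cub D.2) (hw : w < D.1) :
      (i, w) ∈ Finset.range (cub D.2) ×ˢ Finset.range D.1 := by simp [hi, hw]
  rw [hl u (Finset.mem_range.2 hu) v (Finset.mem_range.2 hv) huv]
  exact forall₂_congr fun i hi => and_congr (hg _ (hmem hi hu) _ (hmem hi hv)).symm
    (hg _ (hmem hi hv) _ (hmem hi hu)).symm

section PolyTimeTables

variable {α : Type} [Context α] {v : α → ℕ}

lemma PolyTime.numBits (hv : PolyTime v) : PolyTime fun a => numBits (v a) :=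
  (hv.blockSize.log one_lt_two).add (.const 1)

lemma PolyTime.cubeRow {z : α → ℕ} (hz : PolyTime z) (hv : PolyTime v) :
    PolyTime fun a => cubeRow (base a) (z a) (v a) := by
  classical
  have hk : PolyTime fun a : α => Boxicity.blockSize (base a).1 := polyTime_order.blockSize
  have hq : PolyTime fun a : α => Boxicity.numBits (base a).1 := polyTime_order.numBits
  have hy := (hz.div (.const 2)).div hq
  have hpos : PolyTime fun a => blockPos (Boxicity.blockSize (base a).1)
      (z a / 2 / Boxicity.numBits (base a).1 / familyCount (base a)) (v a) :=
    .ite ((hv.div hk).eq (hy.div polyTime_familyCount)) (hv.mod hk) hk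
  have hside := ((hpos.div_pow (.const 2) ((hz.div (.const 2)).mod hq)).mod (.const 2)).eq
    (hz.mod (.const 2))
  have hreach := PolyTime.reach
    (l := fun a => Boxicity.rowLabel (base a) (z a / 2 / Boxicity.numBits (base a).1))
    (.rowLabel hy.fst .snd) hv
  exact (PolyTime.ite hside hreach ((hk.add (.const 1)).add (.rowLabel hy hv))).congr fun a => by
    simp only [Boxicity.cubeRow, cubePos, Set.mem_ofPred_eq]
    congr

lemma polyTime_boxDim : PolyTime fun D : FinGraph => Boxicity.numBlocks D.1 * familyCount D :=
  (polyTime_order (α := FinGraph)).numBlocks.mul polyTime_familyCount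

lemma polyTime_cubeDim : PolyTime cubeDim :=
  (polyTime_boxDim.mul (polyTime_order (α := FinGraph)).numBits).mul (.const 2)

lemma polyTime_row : PolyTime fun x : FinGraph × ℕ => x.2 / x.1.1 :=
  PolyTime.snd.div polyTime_order.fst

lemma polyTime_column : PolyTime fun x : FinGraph × ℕ => x.2 % x.1.1 :=
  PolyTime.snd.mod polyTime_order.fst

lemma polyTime_tabulate_rowLabel :
    PolyTime fun x : FinGraph × ℕ => tabulate x.1.1 (Boxicity.rowLabel x.1) x.2 :=
  polyTime_row.rowLabel polyTime_column

lemma polyTime_tabulate_reach_rowLabel : PolyTime fun x : FinGraph × ℕ => tabulate x.1.1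
    (fun i => Boxicity.reach x.1.natGraph (Finset.range x.1.1) (Boxicity.rowLabel x.1 i)) x.2 :=
  .reach (l := fun x : FinGraph × ℕ => Boxicity.rowLabel x.1 (x.2 / x.1.1))
    (polyTime_row.fst.rowLabel .snd) polyTime_column

lemma polyTime_tabulate_cubeRow :
    PolyTime fun x : FinGraph × ℕ => tabulate x.1.1 (Boxicity.cubeRow x.1) x.2 :=
  polyTime_row.cubeRow polyTime_column

end PolyTimeTables

/-! ### Asymptotics -/

section Asymptotics

variable {n : ℕ}

lemma numBlocks_le (hn : 0 < n) : (numBlocks n : ℝ) ≤ n / blockSize n + 1 := by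
  have hk := blockSize_pos hn
  have hle : numBlocks n ≤ n / blockSize n + 1 := by
    rw [numBlocks, ceilDiv_le_iff_le_mul hk, mul_comm]
    exact (Nat.lt_div_mul_add hk).le.trans_eq (by ring)
  calc (numBlocks n : ℝ) ≤ ((n / blockSize n : ℕ) : ℝ) + 1 := by exact_mod_cast hle
    _ ≤ n / blockSize n + 1 := by gcongr; exact Nat.cast_div_le

lemma log_log_pos (hn : 3 ≤ n) : 0 < Real.log (Real.log n) := by
  refine Real.log_pos ((Real.lt_log_iff_exp_lt (by positivity)).2 ?_)
  have : (3 : ℝ) ≤ n := by exact_mod_cast hn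
  linarith [Real.exp_one_lt_d9]

lemma three_le_of_log_log (hx : 100 ≤ Real.log (Real.log n)) : 3 ≤ n := by
  by_contra! h
  have hlog : Real.log (Real.log n) ≤ Real.log n :=
    Real.log_le_self (Real.log_natCast_nonneg n)
  have : Real.log n ≤ n := Real.log_le_self n.cast_nonneg
  have : (n : ℝ) < 3 := by exact_mod_cast h
  linarith

lemma log_pos_of_three_le (hn : 3 ≤ n) : 0 < Real.log n := Real.log_pos (by norm_cast; omega)

lemma mul_self_mul_log_le (hx : 100 ≤ Real.log (Real.log n)) {κ : ℕ}
    (hκ : κ + 1 ≤ 5 * √(Real.log n / Real.log (Real.log n))) :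
    κ * κ * Real.log (κ + 1) ≤ 20 * Real.log n := by
  have hy := log_pos_of_three_le (three_le_of_log_log hx)
  set y := Real.log n
  set x := Real.log y with hxy
  have hx0 : 0 < x := by linarith
  set s := √(y / x)
  have hs0 : 0 < s := Real.sqrt_pos.2 (by positivity)
  have hlog : Real.log (κ + 1) ≤ 3 / 5 * x := by
    have hlog_s : Real.log s ≤ x / 2 := by
      rw [hxy, ← Real.log_sqrt hy.le]
      exact Real.log_le_log hs0 (Real.sqrt_le_sqrt (div_le_self hy.le (by linarith)))
    have hlog5 : Real.log 5 ≤ 5 - 1 := Real.log_le_sub_one_of_pos (by norm_num)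
    calc Real.log (κ + 1) ≤ Real.log (5 * s) := Real.log_le_log (by positivity) hκ
      _ = Real.log 5 + Real.log s := Real.log_mul (by norm_num) hs0.ne'
      _ ≤ 3 / 5 * x := by linarith
  have hκ' : (κ : ℝ) ≤ 5 * s := by linarith
  calc κ * κ * Real.log (κ + 1) ≤ 5 * s * (5 * s) * (3 / 5 * x) := by
        gcongr
        exact Real.log_nonneg (by linarith [κ.cast_nonneg (α := ℝ)])
    _ = 15 * (s * s * x) := by ring
    _ = 15 * y := by rw [Real.mul_self_sqrt (by positivity), div_mul_cancel₀ _ hx0.ne']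
    _ ≤ 20 * y := by linarith

lemma five_le_sqrt (hx : 100 ≤ Real.log (Real.log n)) :
    5 ≤ √(Real.log n / Real.log (Real.log n)) := by
  have hy := log_pos_of_three_le (three_le_of_log_log hx)
  have hexp := Real.quadratic_le_exp_of_nonneg (show 0 ≤ Real.log (Real.log n) by linarith)
  rw [Real.exp_log hy] at hexp
  refine Real.le_sqrt_of_sq_le ((le_div_iff₀ (by linarith)).2 ?_)
  nlinarith

lemma le_blockSize (hx : 100 ≤ Real.log (Real.log n)) :
    4 * √(Real.log n / Real.log (Real.log n)) ≤ blockSize n := by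
  have hn := three_le_of_log_log hx
  have hn0 : (0 : ℝ) < n := by positivity
  have hy := log_pos_of_three_le hn
  have hs := five_le_sqrt hx
  have hκ : (⌈4 * √(Real.log n / Real.log (Real.log n))⌉₊ : ℝ) <
    4 * √(Real.log n / Real.log (Real.log n)) + 1 := Nat.ceil_lt_add_one (by positivity)
  refine (Nat.le_ceil _).trans (Nat.cast_le.2 ?_)
  set κ := ⌈4 * √(Real.log n / Real.log (Real.log n))⌉₊
  refine Nat.le_findGreatest ?_ ?_
  · have hss : √(Real.log n / Real.log (Real.log n)) * √(Real.log n / Real.log (Real.log n)) ≤ n :=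
      calc _ = Real.log n / Real.log (Real.log n) := Real.mul_self_sqrt (by positivity)
        _ ≤ Real.log n := div_le_self hy.le (by linarith)
        _ ≤ n := Real.log_le_self hn0.le
    have : (κ : ℝ) ≤ n := by nlinarith
    exact_mod_cast this
  · have hlog := mul_self_mul_log_le hx (κ := κ) (by linarith)
    have hmono : Real.log n ≤ Real.log (n + 1) := Real.log_le_log hn0 (by linarith)
    have : ((κ + 1 : ℝ)) ^ (κ * κ) ≤ (n + 1 : ℝ) ^ 20 := by
      rw [← Real.log_le_log_iff (by positivity) (by positivity), Real.log_pow, Real.log_pow]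
      push_cast
      linarith
    exact_mod_cast this

lemma log_blockSize_le (hn : 3 ≤ n) :
    2 * Real.log (blockSize n) ≤ Real.log 80 + Real.log (Real.log n) := by
  have hk : 0 < blockSize n := blockSize_pos (by omega)
  have hy := log_pos_of_three_le hn
  have hpow : (2 : ℝ) ^ (blockSize n * blockSize n) ≤ (n : ℝ) ^ 40 := by
    have : n + 1 ≤ n ^ 2 := by nlinarith
    calc (2 : ℝ) ^ (blockSize n * blockSize n)
        ≤ ((blockSize n + 1 : ℕ) : ℝ) ^ (blockSize n * blockSize n) := by
          gcongr
          exact_mod_cast Nat.succ_le_succ hk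
      _ ≤ ((n + 1 : ℕ) : ℝ) ^ 20 := by exact_mod_cast blockSize_pow_le n
      _ ≤ ((n ^ 2 : ℕ) : ℝ) ^ 20 := by gcongr
      _ = (n : ℝ) ^ 40 := by push_cast; ring
  have hlog := Real.log_le_log (by positivity) hpow
  rw [Real.log_pow, Real.log_pow] at hlog
  push_cast at hlog
  have hk' : (0 : ℝ) < blockSize n := by exact_mod_cast hk
  have hkk : (blockSize n : ℝ) * blockSize n ≤ 80 * Real.log n := by
    nlinarith [Real.log_two_gt_d9, mul_pos hk' hk']
  have := Real.log_le_log (by positivity) hkk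
  rw [Real.log_mul hk'.ne' hk'.ne', Real.log_mul (by norm_num) hy.ne'] at this
  linarith

lemma numBits_le (hx : 100 ≤ Real.log (Real.log n)) :
    (numBits n : ℝ) ≤ 4 / 5 * Real.log (Real.log n) := by
  have hn := three_le_of_log_log hx
  have hk : 0 < blockSize n := blockSize_pos (by omega)
  have hlog := log_blockSize_le hn
  have hlog80 : Real.log 80 ≤ 7 * Real.log 2 := by
    rw [← Real.log_rpow two_pos]
    exact Real.log_le_log (by norm_num) (by norm_num)
  have hbits : (Nat.log 2 (blockSize n) : ℝ) * Real.log 2 ≤ Real.log (blockSize n) := by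
    rw [← Real.log_pow]
    exact Real.log_le_log (by positivity) (by exact_mod_cast Nat.pow_log_le_self 2 hk.ne')
  rw [numBits]
  push_cast
  nlinarith [Real.log_two_gt_d9]

/-- The factor of the approximation of the boxicity. -/
noncomputable def boxFactor (n : ℕ) : ℝ :=
  (n : ℝ) * √(Real.log (Real.log n)) / √(Real.log n)

lemma boxFactor_pos (hn : 3 ≤ n) : 0 < boxFactor n := by
  have hx := log_log_pos hn
  have hy := log_pos_of_three_le hn
  unfold boxFactor
  positivity

lemma mul_rpow_div_eq_boxFactor_mul (hn : 3 ≤ n) :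
    (n : ℝ) * Real.log (Real.log n) ^ (3 / 2 : ℝ) / √(Real.log n) =
      boxFactor n * Real.log (Real.log n) := by
  have hpow : Real.log (Real.log n) ^ (3 / 2 : ℝ) =
      Real.log (Real.log n) * √(Real.log (Real.log n)) := by
    rw [Real.sqrt_eq_rpow, show (3 / 2 : ℝ) = 1 + 1 / 2 by norm_num,
      Real.rpow_add (log_log_pos hn), Real.rpow_one]
  rw [hpow, boxFactor]
  ring

lemma ten_le_boxFactor (hx : 100 ≤ Real.log (Real.log n)) : 10 ≤ boxFactor n := by
  have hy := log_pos_of_three_le (three_le_of_log_log hx)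
  have hsqrt : 10 ≤ √(Real.log (Real.log n)) := Real.le_sqrt_of_sq_le (by linarith)
  have hlog : Real.log n ≤ n := Real.log_le_self n.cast_nonneg
  have h1 : 1 ≤ Real.log n :=
    (by linarith : (1 : ℝ) ≤ Real.log (Real.log n)).trans (Real.log_le_self hy.le)
  have hle : √(Real.log n) ≤ n := (Real.sqrt_le_iff.2 ⟨hy.le, by nlinarith⟩).trans hlog
  rw [boxFactor, le_div_iff₀ (Real.sqrt_pos.2 hy), mul_comm]
  gcongr

lemma numBlocks_le_boxFactor (hx : 100 ≤ Real.log (Real.log n)) :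
    numBlocks n ≤ boxFactor n / 4 + 1 := by
  have hn := three_le_of_log_log hx
  have hy := log_pos_of_three_le hn
  have hk := le_blockSize hx
  rw [Real.sqrt_div hy.le] at hk
  calc (numBlocks n : ℝ) ≤ n / blockSize n + 1 := numBlocks_le (by omega)
    _ ≤ n / (4 * (√(Real.log n) / √(Real.log (Real.log n)))) + 1 := by gcongr
    _ = boxFactor n / 4 + 1 := by rw [boxFactor]; field_simp

lemma tendsto_log_log : Filter.Tendsto (fun n : ℕ => Real.log (Real.log n)) .atTop .atTop :=
  Real.tendsto_log_atTop.comp (Real.tendsto_log_atTop.comp tendsto_natCast_atTop_atTop)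

lemma eventually_numBlocks_le : ∀ᶠ n in Filter.atTop, numBlocks n ≤ ⌈boxFactor n⌉₊ := by
  filter_upwards [tendsto_log_log.eventually_ge_atTop 100] with n hx
  have hle : (numBlocks n : ℝ) ≤ boxFactor n := by
    linarith [numBlocks_le_boxFactor hx, ten_le_boxFactor hx]
  exact_mod_cast hle.trans (Nat.le_ceil _)

lemma eventually_numBlocks_mul_numBits_le : ∀ᶠ n : ℕ in Filter.atTop,
    2 * (numBlocks n * numBits n) ≤ ⌈boxFactor n * Real.log (Real.log n)⌉₊ := by
  filter_upwards [tendsto_log_log.eventually_ge_atTop 100] with n hx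
  have hfactor := ten_le_boxFactor hx
  have hle : ((2 * (numBlocks n * numBits n) : ℕ) : ℝ) ≤ boxFactor n * Real.log (Real.log n) := by
    push_cast
    calc 2 * ((numBlocks n : ℝ) * numBits n)
        ≤ 2 * ((boxFactor n / 4 + 1) * (4 / 5 * Real.log (Real.log n))) := by
          gcongr
          exacts [numBlocks_le_boxFactor hx, numBits_le hx]
      _ = (2 / 5 * boxFactor n + 8 / 5) * Real.log (Real.log n) := by ring
      _ ≤ boxFactor n * Real.log (Real.log n) := by gcongr; linarith
  exact_mod_cast hle.trans (Nat.le_ceil _)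

end Asymptotics

/-! ### The algorithms -/

lemma exists_prog_isBoxTable : ∃ (p : Prog) (T : Polynomial ℕ),
    ∀ (n : ℕ) (G : SimpleGraph (Fin n)), Runs p (T.eval n) (input G) fun s =>
      IsBoxTable G (s.var 0) (s.arr 1) (s.arr 2) ∧
        (3 ≤ n → s.var 0 ≤ 2 * ⌈boxFactor n⌉₊ * box G) := by
  refine exists_prog_of_eventually
    (R := fun D d X Y => IsBoxTable D.2 d X Y ∧ (3 ≤ D.1 → d ≤ 2 * ⌈boxFactor D.1⌉₊ * box D.2))
    (fun D d X X' Y Y' hXY h => ⟨h.1.congr hXY, h.2⟩) (fun D => ?_) polyTime_boxDim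
    polyTime_tabulate_rowLabel polyTime_tabulate_reach_rowLabel ?_
  · obtain ⟨X, Y, h⟩ := exists_isBoxTable_two_mul_box D
    refine ⟨_, X, Y, h, fun hn => Nat.mul_le_mul_right _ (Nat.le_mul_of_pos_right _ ?_)⟩
    exact Nat.ceil_pos.2 (boxFactor_pos hn)
  · filter_upwards [eventually_numBlocks_le] with n hn G
    refine ⟨isBoxTable_rowLabel ⟨n, G⟩, fun _ => ?_⟩
    calc numBlocks n * familyCount ⟨n, G⟩ ≤ ⌈boxFactor n⌉₊ * (2 * box G) :=
          Nat.mul_le_mul hn (familyCount_le_two_mul_box ⟨n, G⟩)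
      _ = 2 * ⌈boxFactor n⌉₊ * box G := by ring

lemma exists_prog_isCubeTable : ∃ (p : Prog) (T : Polynomial ℕ),
    ∀ (n : ℕ) (G : SimpleGraph (Fin n)), Runs p (T.eval n) (input G) fun s =>
      IsCubeTable G (s.var 0) (s.arr 1) (s.arr 2) ∧
        (3 ≤ n → s.var 0 ≤ 2 * ⌈boxFactor n * Real.log (Real.log n)⌉₊ * cub G) := by
  refine exists_prog_of_eventually (R := fun D d X Y => IsCubeTable D.2 d X Y ∧
      (3 ≤ D.1 → d ≤ 2 * ⌈boxFactor D.1 * Real.log (Real.log D.1)⌉₊ * cub D.2))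
    (fun D d X X' Y Y' hXY h => ⟨h.1.congr hXY, h.2⟩) (fun D => ?_) polyTime_cubeDim
    polyTime_tabulate_cubeRow (polyTime_order.blockSize.add (.const 1)) ?_
  · obtain ⟨X, Y, h⟩ := exists_isCubeTable_cub D
    refine ⟨_, X, Y, h, fun hn => Nat.le_mul_of_pos_left _ (Nat.mul_pos two_pos ?_)⟩
    exact Nat.ceil_pos.2 (mul_pos (boxFactor_pos hn) (log_log_pos hn))
  · filter_upwards [eventually_numBlocks_mul_numBits_le] with n hn G
    refine ⟨isCubeTable_cubeRow ⟨n, G⟩, fun _ => ?_⟩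
    calc cubeDim ⟨n, G⟩ = 2 * (numBlocks n * numBits n) * familyCount ⟨n, G⟩ := by
          rw [cubeDim]
          ring
      _ ≤ ⌈boxFactor n * Real.log (Real.log n)⌉₊ * (2 * cub G) := Nat.mul_le_mul hn
          ((familyCount_le_two_mul_box ⟨n, G⟩).trans (Nat.mul_le_mul_left 2 (box_le_cub ⟨n, G⟩)))
      _ = 2 * ⌈boxFactor n * Real.log (Real.log n)⌉₊ * cub G := by ring

end Boxicity

theorem theorem2 :
    (∃ (p : Boxicity.Prog) (T : Polynomial ℕ), ∀ (n : ℕ) (G : SimpleGraph (Fin n)),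
      ∃ (s : Boxicity.State) (t d : ℕ),
        Boxicity.Exec p (Boxicity.input G) s t ∧ t ≤ T.eval n ∧
        Boxicity.HoldsBoxRepresentation G s d ∧
        (3 ≤ n →
          d ≤ 2 * ⌈(n : ℝ) * √(Real.log (Real.log n)) / √(Real.log n)⌉₊ * Boxicity.box G)) ∧
    (∃ (p : Boxicity.Prog) (T : Polynomial ℕ), ∀ (n : ℕ) (G : SimpleGraph (Fin n)),
      ∃ (s : Boxicity.State) (t d : ℕ),
        Boxicity.Exec p (Boxicity.input G) s t ∧ t ≤ T.eval n ∧
        Boxicity.HoldsCubeRepresentation G s d ∧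
        (3 ≤ n →
          d ≤ 2 * ⌈(n : ℝ) * Real.log (Real.log n) ^ (3 / 2 : ℝ) / √(Real.log n)⌉₊ *
            Boxicity.cub G)) := by
  constructor
  · obtain ⟨p, T, hp⟩ := Boxicity.exists_prog_isBoxTable
    refine ⟨p, T, fun n G => ?_⟩
    obtain ⟨s, t, h, ht, htable, hd⟩ := hp n G
    exact ⟨s, t, s.var 0, h, ht, ⟨rfl, htable⟩, hd⟩
  · obtain ⟨p, T, hp⟩ := Boxicity.exists_prog_isCubeTable
    refine ⟨p, T, fun n G => ?_⟩
    obtain ⟨s, t, h, ht, htable, hd⟩ := hp n G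
    refine ⟨s, t, s.var 0, h, ht, ⟨rfl, htable⟩, fun hn => ?_⟩
    rw [Boxicity.mul_rpow_div_eq_boxFactor_mul hn]
    exact hd hn
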